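/- Let $n \ge 1$, $s \in (0,1)$ and $1 \le p < \infty$. Let $K \subset \mathbb{R}^n$ be an origin-symmetric convex body (compact, convex, with non-empty interior), let $\|\cdot\|_K$ be the norm on $\mathbb{R}^n$ with closed unit ball $K$, and assume that $K$ is symmetric with respect to the hyperplane $\{x_n = 0\}$. Let $W^{s,p}(\mathbb{R}^n)$ be the set of all real-valued $f \in L^p(\mathbb{R}^n)$ with $$\int_{\mathbb{R}^n}\int_{\mathbb{R}^n} \frac{|f(x)-f(y)|^p}{|x-y|^{n+sp}}\,dy\,dx < \infty .$$ Write $x = (x',x_n) \in \mathbb{R}^{n-1}\times\mathbb{R}$. For $A \subseteq \mathbb{R}$ let $A^*$ be the open interval centered at $0$ with the same Lebesgue measure as $A$ ($A^* = \mathbb{R}$ if $|A| = \infty$, $A^* = \emptyset$ if $|A| = 0$). The Steiner symmetrization of $f$ with respect to $x_n$ is defined, up to a set of measure zero, by $$f^{\#}(x',x_n) = \sup\{\tau > 0 : x_n \in \{y \in \mathbb{R} : f(x',y) > \tau\}^*\}, \qquad \sup\emptyset = 0 .$$ If $f \in W^{s,p}(\mathbb{R}^n)$, then $f^{\#} \in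 W^{s,p}(\mathbb{R}^n)$ and $$\int_{\mathbb{R}^n}\int_{\mathbb{R}^n} \frac{|f(x)-f(y)|^p}{\|x-y\|_K^{n+sp}}\,dy\,dx \;\ge\; \int_{\mathbb{R}^n}\int_{\mathbb{R}^n} \frac{|f^{\#}(x)-f^{\#}(y)|^p}{\|x-y\|_K^{n+sp}}\,dy\,dx . \qquad (1)$$ Furthermore, assume that $K$ is strictly convex, that is, $(1-\lambda)x+\lambda y \in \operatorname{int} K$ for all $x \ne y$ in $K$ and $0<\lambda<1$. (a) If $p > 1$, equality holds in (1) if and only if there exists $c \in \mathbb{R}$ such that for a.e. $x' \in \mathbb{R}^{n-1}$, $$f(x',x_n) = f^{\#}(x',x_n-c) \quad \text{for a.e. } x_n \in \mathbb{R}.$$ (b) If $p = 1$, equality holds in (1) if and only if $f \ge 0$ a.e. and for a.e. $\tau > 0$ there exists $c_\tau \in \mathbb{R}$ such that for a.e. $x' \in \mathbb{R}^{n-1}$ the set $\{x_n \in \mathbb{R} : f(x',x_n) > \tau\}$ coincides, up to a set of measure zero, with a bounded (possibly empty) interval centered at $c_\tau$. -/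

import Mathlib

open MeasureTheory Set

noncomputable section

/-- The point `(x', t)` of `ℝ^(m+1) = ℝ^m × ℝ`; `t` is the last coordinate. -/
def joinLast {m : ℕ} (x' : EuclideanSpace ℝ (Fin m)) (t : ℝ) : EuclideanSpace ℝ (Fin (m + 1)) :=
  WithLp.toLp 2 (Fin.snoc (α := fun _ => ℝ) x'.ofLp t)

/-- The first `m` coordinates `x'` of a point `x = (x', t)` of `ℝ^(m+1)`. -/
def initCoords {m : ℕ} (x : EuclideanSpace ℝ (Fin (m + 1))) : EuclideanSpace ℝ (Fin m) :=
  WithLp.toLp 2 (fun i => x i.castSucc)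

/-- Convex bodies: compact convex sets with non-empty interior. -/
structure IsConvexBody {d : ℕ} (K : Set (EuclideanSpace ℝ (Fin d))) : Prop where
  isCompact : IsCompact K
  convex : Convex ℝ K
  interior_nonempty : (interior K).Nonempty

/-- Symmetry of a set with respect to the hyperplane where the last coordinate vanishes. -/
def IsSymmetricInLast {m : ℕ} (K : Set (EuclideanSpace ℝ (Fin (m + 1)))) : Prop :=
  ∀ (x' : EuclideanSpace ℝ (Fin m)) (t : ℝ), joinLast x' t ∈ K → joinLast x' (-t) ∈ K

/-- The double integral `∬ |f x - f y|^p / N (x - y)^(d + s p) dy dx`, with values in `[0, ∞]`.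
For the norm with unit ball `K` take `N = gauge K`, for the Euclidean norm `N = norm`. -/
def fracEnergy {d : ℕ} (N : EuclideanSpace ℝ (Fin d) → ℝ) (s p : ℝ)
    (f : EuclideanSpace ℝ (Fin d) → ℝ) : ENNReal :=
  ∫⁻ x, ∫⁻ y, ENNReal.ofReal (|f x - f y| ^ p / N (x - y) ^ ((d : ℝ) + s * p))

/-- Membership in the fractional Sobolev space `W^{s,p}(ℝ^d)`: `f ∈ L^p` and the seminorm
`[f]_{s,p}` is finite. -/
def MemFracSobolev {d : ℕ} (s p : ℝ) (f : EuclideanSpace ℝ (Fin d) → ℝ) : Prop :=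
  MemLp f (ENNReal.ofReal p) volume ∧ fracEnergy (fun z => ‖z‖) s p f ^ (1 / p) < ⊤

/-- The Schwarz symmetrization of a subset of the line: the open interval centered at `0` with the
same measure (the whole line if the measure is infinite, empty if it is zero). -/
def schwarzSymm (A : Set ℝ) : Set ℝ :=
  {t | ENNReal.ofReal (2 * |t|) < volume A}

/-- The Steiner symmetrization `f^#` of `f` with respect to the last coordinate:
`f^# (x', t) = sup {τ > 0 | t ∈ {y | f (x', y) > τ}^*}`, with `sup ∅ = 0`.
For `f ∈ L^p` the supremum is finite outside a set of measure zero. -/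
def steinerSymm {m : ℕ} (f : EuclideanSpace ℝ (Fin (m + 1)) → ℝ)
    (x : EuclideanSpace ℝ (Fin (m + 1))) : ℝ :=
  sSup {τ : ℝ | 0 < τ ∧ x (Fin.last m) ∈ schwarzSymm {y | f (joinLast (initCoords x) y) > τ}}

end

/-! Write points as `(x, t)` with `t` the last coordinate, and let `N` be the gauge of `K`. The
energy is opened up by three layer cakes: `d ^ p` is a `ν`-superposition of the functions `(d -
h)⁺`; `(a - b - h)⁺` is the length of the set of levels `σ` with `a > σ + h` and `b ≤ σ`; and `n ^
(-q)` is the `η`-mass of `(n, ∞)`. The energy of a nonnegative `F` is then twice an integral over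
`(h, σ, x, y, r)` of the measure of the pairs `(t, u)` with `F x t > σ + h`, `F y u ≤ σ` and `N (x -
y, t - u) < r` (`sliceEnergy_eq_lintegral_levelPairs`). Convexity and the symmetries of `K` turn the
last condition into `|t - u| < ρ` for some `ρ` depending on `x, y, r`.

For fixed parameters, the inequality is therefore the Riesz rearrangement inequality on the line for
two sets and a centered interval (`overlap_le_overlap_Ioo`). It is used with the second set
complemented (`overlap_compl_Ioo_le`). A signed `f` is first replaced by its positive part, which
has the same symmetrization and no larger energy.

In the equality case the energies are finite, so Riesz equality holds for almost all parameters.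
Strict convexity makes `N` strictly increasing in `t ≥ 0`, so the admissible radii `ρ` come
arbitrarily close from above to half the sum of the lengths `a`, `b` of the two level sets. Equality
there says that almost every two points of these sets are at distance at most `(a + b) / 2`, which
forces concentric intervals (`concentric_of_overlap_compl_eq`). Comparing different base points
makes the center independent of `x` (`exists_common_center`).

The dichotomy in `p` comes from `ν`. For `p > 1` it has a positive density on `(0, ∞)`, so almost
all pairs of distinct levels are compared and one center serves all of them
(`exists_center_all_levels`). For `p = 1` it is the Dirac mass at `0`, each level is compared only
with itself, and the center may depend on the level. Equality in the passage to the positive part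
forces `f ≥ 0`, since otherwise `f` would be a nonzero constant in `L^p`. -/

/-! ### The Riesz inequality on the line for two sets and an interval -/

/-- The measure of the pairs `(t, u) ∈ A × B` with `|t - u| < ρ`. -/
noncomputable def overlap (A B : Set ℝ) (ρ : ℝ) : ENNReal :=
  volume {z : ℝ × ℝ | z.1 ∈ A ∧ z.2 ∈ B ∧ |z.1 - z.2| < ρ}

theorem measurableSet_overlap {A B : Set ℝ} (hA : MeasurableSet A) (hB : MeasurableSet B) (ρ : ℝ) :
    MeasurableSet {z : ℝ × ℝ | z.1 ∈ A ∧ z.2 ∈ B ∧ |z.1 - z.2| < ρ} :=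
  (measurable_fst hA).inter ((measurable_snd hB).inter
    (measurableSet_lt (f := fun z : ℝ × ℝ => |z.1 - z.2|) (by fun_prop) measurable_const))

theorem overlap_eq_lintegral {A B : Set ℝ} (hA : MeasurableSet A) (hB : MeasurableSet B) (ρ : ℝ) :
    overlap A B ρ = ∫⁻ t in A, volume (B ∩ Ioo (t - ρ) (t + ρ)) := by
  rw [overlap, Measure.volume_eq_prod, Measure.prod_apply (measurableSet_overlap hA hB ρ),
    ← lintegral_indicator hA]
  refine lintegral_congr fun t => ?_
  by_cases ht : t ∈ A
  · rw [indicator_of_mem ht]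
    congr 1
    ext u
    simp only [mem_preimage, mem_ofPred_eq, ht, true_and, mem_inter_iff, mem_Ioo, abs_lt]
    constructor <;> rintro ⟨h1, h2, h3⟩ <;> refine ⟨h1, ?_, ?_⟩ <;> linarith
  · rw [indicator_of_notMem ht]
    simp [ht]

theorem overlap_comm {A B : Set ℝ} (hA : MeasurableSet A) (hB : MeasurableSet B) (ρ : ℝ) :
    overlap A B ρ = overlap B A ρ := by
  have h := (Measure.measurePreserving_swap (μ := (volume : Measure ℝ)) (ν := volume)).measure_preimage
    (measurableSet_overlap hB hA ρ).nullMeasurableSet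
  rw [overlap, overlap, Measure.volume_eq_prod, ← h]
  congr 1
  ext z
  simp only [mem_ofPred_eq, mem_preimage, Prod.fst_swap, Prod.snd_swap, abs_sub_comm z.2 z.1]
  tauto

theorem overlap_le_mul {A B : Set ℝ} (ρ : ℝ) : overlap A B ρ ≤ volume A * volume B := by
  rw [← Measure.prod_prod, ← Measure.volume_eq_prod]
  exact measure_mono fun z hz => ⟨hz.1, hz.2.1⟩

theorem overlap_le_mul_length {A B : Set ℝ} (hA : MeasurableSet A) (hB : MeasurableSet B) (ρ : ℝ) :
    overlap A B ρ ≤ volume A * ENNReal.ofReal (2 * ρ) := by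
  rw [overlap_eq_lintegral hA hB]
  calc ∫⁻ t in A, volume (B ∩ Ioo (t - ρ) (t + ρ)) ≤ ∫⁻ _ in A, ENNReal.ofReal (2 * ρ) := by
        refine lintegral_mono fun t => (measure_mono inter_subset_right).trans ?_
        rw [Real.volume_Ioo]
        exact ENNReal.ofReal_le_ofReal (by linarith)
    _ = _ := by rw [setLIntegral_const, mul_comm]

theorem overlap_congr {A B A' B' : Set ℝ} (hA : A =ᵐ[volume] A') (hB : B =ᵐ[volume] B') (ρ : ℝ) :
    overlap A B ρ = overlap A' B' ρ := by
  refine measure_congr ?_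
  have h1 : ∀ᵐ z : ℝ × ℝ, (z.1 ∈ A ↔ z.1 ∈ A') :=
    Measure.quasiMeasurePreserving_fst.ae (p := fun t => t ∈ A ↔ t ∈ A') (hA.mono fun t ht => ht.to_iff)
  have h2 : ∀ᵐ z : ℝ × ℝ, (z.2 ∈ B ↔ z.2 ∈ B') :=
    Measure.quasiMeasurePreserving_snd.ae (p := fun t => t ∈ B ↔ t ∈ B') (hB.mono fun t ht => ht.to_iff)
  filter_upwards [h1, h2] with z hz1 hz2
  exact propext (by
    change (z.1 ∈ A ∧ z.2 ∈ B ∧ |z.1 - z.2| < ρ) ↔ (z.1 ∈ A' ∧ z.2 ∈ B' ∧ |z.1 - z.2| < ρ)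
    rw [hz1, hz2])

/-- If a set is covered, up to a point, by a chain of open sets each of which meets `B` in measure
at most `c`, then the set meets `B` in measure at most `c`. -/
theorem measure_inter_le_of_chain {B S : Set ℝ} {c : ENNReal} {U : ℝ → Set ℝ}
    (hU : ∀ u, IsOpen (U u)) (hchain : ∀ u v, U u ⊆ U v ∨ U v ⊆ U u)
    (hsub : (S \ ⋃ u ∈ S, U u).Subsingleton) (hc : ∀ u ∈ S, volume (B ∩ U u) ≤ c) :
    volume (B ∩ S) ≤ c := by
  -- Lindelöf reduces to countably many members. They still form a chain, so the measure of their
  -- union is the supremum of the measures.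
  obtain ⟨T, hTS, hT, hTU⟩ := TopologicalSpace.isOpen_biUnion_countable S U fun u _ => hU u
  have h1 : volume (⋃ u ∈ T, B ∩ U u) ≤ c := by
    rw [measure_biUnion_eq_iSup hT]
    · exact iSup₂_le fun u hu => hc u (hTS hu)
    · intro u hu v hv
      rcases hchain u v with h | h
      · exact ⟨v, hv, inter_subset_inter_right _ h, subset_rfl⟩
      · exact ⟨u, hu, subset_rfl, inter_subset_inter_right _ h⟩
  have h2 : B ∩ S ⊆ (⋃ u ∈ T, B ∩ U u) ∪ (S \ ⋃ u ∈ S, U u) := by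
    intro x hx
    by_cases hxU : x ∈ ⋃ u ∈ S, U u
    · left
      rw [← hTU] at hxU
      rw [← inter_iUnion₂]
      exact ⟨hx.1, hxU⟩
    · exact Or.inr ⟨hx.2, hxU⟩
  calc volume (B ∩ S) ≤ volume (⋃ u ∈ T, B ∩ U u) + volume (S \ ⋃ u ∈ S, U u) :=
        (measure_mono h2).trans (measure_union_le _ _)
    _ ≤ c := by rw [hsub.measure_zero, add_zero]; exact h1

theorem measure_inter_le_of_forall_Ioi {B S : Set ℝ} {c : ENNReal}
    (hc : ∀ u ∈ S, volume (B ∩ Ioi u) ≤ c) : volume (B ∩ S) ≤ c := by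
  refine measure_inter_le_of_chain (U := Ioi) (fun _ => isOpen_Ioi) (fun u v => ?_) ?_ hc
  · rcases le_total u v with h | h
    · exact Or.inr (Ioi_subset_Ioi h)
    · exact Or.inl (Ioi_subset_Ioi h)
  · rintro x ⟨hx, hx'⟩ y ⟨hy, hy'⟩
    simp only [mem_iUnion, mem_Ioi, not_exists, not_lt] at hx' hy'
    exact le_antisymm (hx' y hy) (hy' x hx)

theorem measure_inter_le_of_forall_Iio {B S : Set ℝ} {c : ENNReal}
    (hc : ∀ u ∈ S, volume (B ∩ Iio u) ≤ c) : volume (B ∩ S) ≤ c := by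
  refine measure_inter_le_of_chain (U := Iio) (fun _ => isOpen_Iio) (fun u v => ?_) ?_ hc
  · rcases le_total u v with h | h
    · exact Or.inl (Iio_subset_Iio h)
    · exact Or.inr (Iio_subset_Iio h)
  · rintro x ⟨hx, hx'⟩ y ⟨hy, hy'⟩
    simp only [mem_iUnion, mem_Iio, not_exists, not_lt] at hx' hy'
    exact le_antisymm (hy' x hx) (hx' y hy)

theorem measurable_measure_inter_Ioo {B : Set ℝ} (hB : MeasurableSet B) (ρ : ℝ) :
    Measurable fun z : ℝ × ℝ => volume (B ∩ Ioo z.2 (z.1 + ρ)) := by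
  have h : MeasurableSet {w : (ℝ × ℝ) × ℝ | w.2 ∈ B ∧ w.1.2 < w.2 ∧ w.2 < w.1.1 + ρ} :=
    (measurable_snd hB).inter ((measurableSet_lt (f := fun w : (ℝ × ℝ) × ℝ => w.1.2)
      (g := fun w => w.2) (by fun_prop) (by fun_prop)).inter
      (measurableSet_lt (f := fun w : (ℝ × ℝ) × ℝ => w.2) (g := fun w => w.1.1 + ρ)
        (by fun_prop) (by fun_prop)))
  exact measurable_measure_prodMk_left h

/-- Points of `B` in the window with at most `l` of `B` between them and the right end have total
measure at most `l`, by exhausting them from the right. -/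
theorem measure_window_le {B : Set ℝ} (c d : ℝ) (l : ENNReal) :
    volume (B ∩ Ioo c d) ≤ l + volume {u | u ∈ B ∩ Ioo c d ∧ l < volume (B ∩ Ioo u d)} := by
  set S := {u | u ∈ Ioo c d ∧ volume (B ∩ Ioo u d) ≤ l}
  have hS : volume ((B ∩ Iio d) ∩ S) ≤ l := by
    refine measure_inter_le_of_forall_Ioi fun u hu => ?_
    have : B ∩ Iio d ∩ Ioi u = B ∩ Ioo u d := by
      ext x; simp only [mem_inter_iff, mem_Iio, mem_Ioi, mem_Ioo]; tauto
    rw [this]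
    exact hu.2
  calc volume (B ∩ Ioo c d)
      ≤ volume (((B ∩ Iio d) ∩ S) ∪ {u | u ∈ B ∩ Ioo c d ∧ l < volume (B ∩ Ioo u d)}) := by
        refine measure_mono fun u hu => ?_
        rcases le_or_gt (volume (B ∩ Ioo u d)) l with h | h
        · exact Or.inl ⟨⟨hu.1, hu.2.2⟩, hu.2, h⟩
        · exact Or.inr ⟨hu, h⟩
    _ ≤ _ := (measure_union_le _ _).trans (by gcongr)

/-- If more than `l` of `B` lies to the right of `u`, then at most `volume B - l` lies to its left.
Exhausting the set of such `u` from the left gives the bound. -/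
theorem measure_left_part_le {B : Set ℝ} (hB : MeasurableSet B)
    (l : ENNReal) : volume (B ∩ {u | l < volume (B ∩ Ioi u)}) ≤ volume B - l := by
  refine measure_inter_le_of_forall_Iio fun u hu => ?_
  have h1 : volume (B ∩ Iio u) + volume (B ∩ Ioi u) ≤ volume B := by
    rw [← measure_union (by
      rw [disjoint_left]; intro x hx hx'; exact lt_asymm (mem_Iio.1 hx.2) (mem_Ioi.1 hx'.2)) (hB.inter measurableSet_Ioi)]
    exact measure_mono (union_subset inter_subset_left inter_subset_left)
  have hu' : l < volume (B ∩ Ioi u) := hu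
  refine ENNReal.le_sub_of_add_le_right (ne_top_of_lt hu') ?_
  exact le_trans (by gcongr) h1

/-- The main estimate for the overlap: it bounds the integral of the excess of
`t ↦ |B ∩ (t - ρ, t + ρ)|` over the level `l`. -/
theorem overlap_le_level {A B : Set ℝ} (hA : MeasurableSet A) (hB : MeasurableSet B)
    (ρ : ℝ) {l : ℝ} (hl : 0 ≤ l) :
    overlap A B ρ ≤ volume A * ENNReal.ofReal l +
      (volume B - ENNReal.ofReal l) * ENNReal.ofReal (2 * ρ - l) := by
  -- The excess of the window mass over `l` is dominated by the section of `W` at `t`. Dropping `t ∈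
  -- A` and integrating in `t` first, each `u` contributes at most the length of `(u + l - ρ, u +
  -- ρ)`, and only points `u` with more than `l` of `B` to their right contribute.
  set W : Set (ℝ × ℝ) := {z | z.2 ∈ B ∧ |z.1 - z.2| < ρ ∧
    ENNReal.ofReal l < volume (B ∩ Ioo z.2 (z.1 + ρ))} with hW
  have hWm : MeasurableSet W :=
    (measurable_snd hB).inter ((measurableSet_lt (f := fun z : ℝ × ℝ => |z.1 - z.2|)
      (by fun_prop) measurable_const).inter (measurableSet_lt measurable_const (measurable_measure_inter_Ioo hB ρ)))
  have h1 : ∀ t, volume (B ∩ Ioo (t - ρ) (t + ρ)) ≤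
      ENNReal.ofReal l + volume (Prod.mk t ⁻¹' W) := by
    intro t
    refine (measure_window_le (t - ρ) (t + ρ) (ENNReal.ofReal l)).trans ?_
    gcongr
    rintro u ⟨⟨hu1, hu2⟩, hu3⟩
    exact ⟨hu1, abs_lt.2 ⟨by linarith [hu2.2], by linarith [hu2.1]⟩, hu3⟩
  have h2 : ∀ u, volume ((fun t => (t, u)) ⁻¹' W) ≤
      (B ∩ {u | ENNReal.ofReal l < volume (B ∩ Ioi u)}).indicator
        (fun _ => ENNReal.ofReal (2 * ρ - l)) u := by
    intro u
    by_cases hu : u ∈ B ∩ {u | ENNReal.ofReal l < volume (B ∩ Ioi u)}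
    · rw [indicator_of_mem hu]
      have : (fun t => (t, u)) ⁻¹' W ⊆ Ioo (u + l - ρ) (u + ρ) := by
        rintro t ⟨_, ht2, ht3⟩
        have ht3' : ENNReal.ofReal l < volume (B ∩ Ioo u (t + ρ)) := ht3
        have h4 := ht3'.trans_le (measure_mono inter_subset_right)
        rw [Real.volume_Ioo] at h4
        have h5 := (ENNReal.ofReal_lt_ofReal_iff_of_nonneg hl).1 h4
        have h6 : t - u < ρ := (abs_lt.1 ht2).2
        exact ⟨by linarith, by linarith⟩
      refine (measure_mono this).trans ?_
      rw [Real.volume_Ioo]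
      exact ENNReal.ofReal_le_ofReal (by linarith)
    · rw [indicator_of_notMem hu, nonpos_iff_eq_zero]
      have : (fun t => (t, u)) ⁻¹' W = ∅ := by
        ext t
        simp only [mem_preimage, mem_empty_iff_false, iff_false]
        rintro ⟨ht1, _, ht3⟩
        refine hu ⟨ht1, lt_of_lt_of_le ht3 (measure_mono ?_)⟩
        exact inter_subset_inter_right _ fun x hx => hx.1
      rw [this, measure_empty]
  have hm1 : MeasurableSet (B ∩ {u | ENNReal.ofReal l < volume (B ∩ Ioi u)}) := by
    refine hB.inter (measurableSet_lt measurable_const ?_)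
    refine Antitone.measurable fun u v huv => measure_mono ?_
    exact inter_subset_inter_right _ (Ioi_subset_Ioi huv)
  calc overlap A B ρ = ∫⁻ t in A, volume (B ∩ Ioo (t - ρ) (t + ρ)) :=
        overlap_eq_lintegral hA hB ρ
    _ ≤ ∫⁻ t in A, (ENNReal.ofReal l + volume (Prod.mk t ⁻¹' W)) := lintegral_mono h1
    _ = volume A * ENNReal.ofReal l + ∫⁻ t in A, volume (Prod.mk t ⁻¹' W) := by
        rw [lintegral_add_left measurable_const, setLIntegral_const, mul_comm]
    _ ≤ volume A * ENNReal.ofReal l + ∫⁻ t, volume (Prod.mk t ⁻¹' W) := by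
        gcongr
        exact Measure.restrict_le_self
    _ = volume A * ENNReal.ofReal l + ∫⁻ u, volume ((fun t => (t, u)) ⁻¹' W) := by
        rw [← Measure.prod_apply hWm, Measure.prod_apply_symm hWm]
    _ ≤ volume A * ENNReal.ofReal l + ∫⁻ u, (B ∩ {u | ENNReal.ofReal l <
          volume (B ∩ Ioi u)}).indicator (fun _ => ENNReal.ofReal (2 * ρ - l)) u := by
        gcongr with u
        exact h2 u
    _ ≤ _ := by
        rw [lintegral_indicator hm1, setLIntegral_const, mul_comm (ENNReal.ofReal (2 * ρ - l))]
        gcongr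
        exact measure_left_part_le hB _

/-- The integrand changes branch at `b / 2 - ρ`, which the hypotheses place inside the interval of
integration. -/
theorem integral_min_add {a b ρ : ℝ} (h1 : -(a / 2) ≤ b / 2 - ρ) (h2 : b / 2 - ρ ≤ a / 2) :
    ∫ t in (-(a / 2))..(a / 2), min (b / 2) (t + ρ) =
      ((b / 2 - ρ) ^ 2 - (a / 2) ^ 2) / 2 + ρ * (b / 2 - ρ + a / 2) +
        b / 2 * (a / 2 - (b / 2 - ρ)) := by
  have hc : Continuous fun t : ℝ => min (b / 2) (t + ρ) := by fun_prop
  rw [← intervalIntegral.integral_add_adjacent_intervals (b := b / 2 - ρ)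
    (hc.intervalIntegrable _ _) (hc.intervalIntegrable _ _)]
  have e1 : ∫ t in (-(a / 2))..(b / 2 - ρ), min (b / 2) (t + ρ) =
      ∫ t in (-(a / 2))..(b / 2 - ρ), (t + ρ) := by
    refine intervalIntegral.integral_congr fun t ht => ?_
    rw [uIcc_of_le h1] at ht
    exact min_eq_right (by linarith [ht.2])
  have e2 : ∫ t in (b / 2 - ρ)..(a / 2), min (b / 2) (t + ρ) =
      ∫ t in (b / 2 - ρ)..(a / 2), (b / 2) := by
    refine intervalIntegral.integral_congr fun t ht => ?_
    rw [uIcc_of_le h2] at ht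
    exact min_eq_left (by linarith [ht.1])
  rw [e1, e2, intervalIntegral.integral_add (by simp) (by simp)]
  simp only [integral_id, intervalIntegral.integral_const, smul_eq_mul]
  ring

/-- The overlap of centered intervals in the range where the three lengths satisfy the triangle
inequality. -/
theorem le_overlap_Ioo_of_triangle {a b ρ : ℝ} (ha : 0 ≤ a) (hab : 2 * ρ ≤ a + b)
    (hba : b ≤ a + 2 * ρ) (hab' : a ≤ b + 2 * ρ) :
    ENNReal.ofReal (a * ((2 * ρ + b - a) / 2) +
      (b - (2 * ρ + b - a) / 2) * (2 * ρ - (2 * ρ + b - a) / 2)) ≤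
      overlap (Ioo (-(a / 2)) (a / 2)) (Ioo (-(b / 2)) (b / 2)) ρ := by
  have hc : Continuous fun t : ℝ => min (b / 2) (t + ρ) := by fun_prop
  have hc' : Continuous fun t : ℝ => min (b / 2) (-t + ρ) := by fun_prop
  have e : ∫ t in (-(a / 2))..(a / 2), (min (b / 2) (t + ρ) + min (b / 2) (-t + ρ)) =
      a * ((2 * ρ + b - a) / 2) +
        (b - (2 * ρ + b - a) / 2) * (2 * ρ - (2 * ρ + b - a) / 2) := by
    rw [intervalIntegral.integral_add (hc.intervalIntegrable _ _) (hc'.intervalIntegrable _ _),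
      intervalIntegral.integral_comp_neg (fun t => min (b / 2) (t + ρ)), neg_neg,
      integral_min_add (by linarith) (by linarith)]
    ring
  rw [overlap_eq_lintegral measurableSet_Ioo measurableSet_Ioo, ← e,
    intervalIntegral.integral_of_le (by linarith), integral_Ioc_eq_integral_Ioo,
    ofReal_integral_eq_lintegral_ofReal]
  · refine setLIntegral_mono' measurableSet_Ioo fun t _ => ?_
    rw [Ioo_inter_Ioo, Real.volume_Ioo]
    refine ENNReal.ofReal_le_ofReal ?_
    have : max (-(b / 2)) (t - ρ) = - min (b / 2) (-t + ρ) := by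
      rw [← max_neg_neg]; congr 1; ring
    rw [this]
    linarith
  · exact ((hc.add hc').integrableOn_Icc (a := -(a / 2)) (b := a / 2)).mono_set Ioo_subset_Icc_self
  · refine (ae_restrict_iff' measurableSet_Ioo).2 (Filter.Eventually.of_forall fun t ht => ?_)
    have h1 := ht.1
    have h2 := ht.2
    change 0 ≤ min (b / 2) (t + ρ) + min (b / 2) (-t + ρ)
    rcases min_cases (b / 2) (t + ρ) with h | h <;>
      rcases min_cases (b / 2) (-t + ρ) with h' | h' <;> linarith

theorem overlap_Ioo_of_contained {a b ρ : ℝ} (hab : a + 2 * ρ ≤ b) :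
    ENNReal.ofReal a * ENNReal.ofReal (2 * ρ) ≤
      overlap (Ioo (-(a / 2)) (a / 2)) (Ioo (-(b / 2)) (b / 2)) ρ := by
  rw [overlap_eq_lintegral measurableSet_Ioo measurableSet_Ioo]
  calc ENNReal.ofReal a * ENNReal.ofReal (2 * ρ)
      = ∫⁻ _ in Ioo (-(a / 2)) (a / 2), ENNReal.ofReal (2 * ρ) := by
        rw [setLIntegral_const, Real.volume_Ioo, mul_comm]
        congr 2
        ring
    _ ≤ _ := by
        refine setLIntegral_mono' measurableSet_Ioo fun t ht => ?_
        have h1 := ht.1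
        have h2 := ht.2
        rw [inter_eq_right.2 (Ioo_subset_Ioo (by linarith) (by linarith)), Real.volume_Ioo]
        exact ENNReal.ofReal_le_ofReal (by linarith)

theorem overlap_Ioo_of_large {a b ρ : ℝ} (hab : a + b ≤ 2 * ρ) :
    ENNReal.ofReal a * ENNReal.ofReal b ≤
      overlap (Ioo (-(a / 2)) (a / 2)) (Ioo (-(b / 2)) (b / 2)) ρ := by
  have : ENNReal.ofReal a * ENNReal.ofReal b =
      volume (Ioo (-(a / 2)) (a / 2) ×ˢ Ioo (-(b / 2)) (b / 2)) := by
    rw [Measure.volume_eq_prod, Measure.prod_prod, Real.volume_Ioo, Real.volume_Ioo]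
    congr 2 <;> ring
  rw [this]
  refine measure_mono fun z hz => ⟨hz.1, hz.2, ?_⟩
  rcases hz with ⟨⟨h1, h2⟩, h3, h4⟩
  rw [abs_lt]
  constructor <;> linarith

/-- The rearrangement inequality of Riesz on the line, for two sets and an interval. -/
theorem overlap_le_overlap_Ioo {A B : Set ℝ} (hA : MeasurableSet A) (hB : MeasurableSet B)
    {a b : ℝ} (ha : 0 ≤ a) (hAa : volume A = ENNReal.ofReal a)
    (hBb : volume B = ENNReal.ofReal b) (ρ : ℝ) :
    overlap A B ρ ≤ overlap (Ioo (-(a / 2)) (a / 2)) (Ioo (-(b / 2)) (b / 2)) ρ := by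
  rcases le_total (a + b) (2 * ρ) with h1 | h1
  · refine (overlap_le_mul ρ).trans ?_
    rw [hAa, hBb]
    exact overlap_Ioo_of_large h1
  rcases le_total (a + 2 * ρ) b with h2 | h2
  · refine (overlap_le_mul_length hA hB ρ).trans ?_
    rw [hAa]
    exact overlap_Ioo_of_contained h2
  rcases le_total (b + 2 * ρ) a with h3 | h3
  · rw [overlap_comm hA hB, overlap_comm measurableSet_Ioo measurableSet_Ioo]
    refine (overlap_le_mul_length hB hA ρ).trans ?_
    rw [hBb]
    exact overlap_Ioo_of_contained h3
  · refine le_trans ?_ (le_overlap_Ioo_of_triangle ha h1 h2 h3)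
    -- This level is the value of the window function of `(-(b / 2), b / 2)` at the endpoint `t = a
    -- / 2`, as in the bathtub principle. The three triangle inequalities are exactly nonnegativity
    -- of `l`, `b - l` and `2 * ρ - l`.
    have hl : 0 ≤ (2 * ρ + b - a) / 2 := by linarith
    refine (overlap_le_level hA hB ρ hl).trans
      (le_of_eq ?_)
    rw [hAa, hBb, ← ENNReal.ofReal_sub _ hl, ← ENNReal.ofReal_mul ha,
      ← ENNReal.ofReal_mul (by linarith), ← ENNReal.ofReal_add (mul_nonneg ha hl)]
    exact mul_nonneg (by linarith) (by linarith)

/-! ### Overlap with a complement, and the case of equality -/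

theorem overlap_add_overlap_compl {A B : Set ℝ} (hA : MeasurableSet A) (hB : MeasurableSet B)
    (ρ : ℝ) : overlap A B ρ + overlap A Bᶜ ρ = volume A * ENNReal.ofReal (2 * ρ) := by
  have hm : Measurable fun t : ℝ => volume (B ∩ Ioo (t - ρ) (t + ρ)) := by
    have := (measurable_measure_inter_Ioo hB ρ).comp
      (f := fun t : ℝ => (t, t - ρ)) (by fun_prop)
    exact this
  rw [overlap_eq_lintegral hA hB, overlap_eq_lintegral hA hB.compl, ← lintegral_add_left hm,
    mul_comm, ← setLIntegral_const]
  refine lintegral_congr fun t => ?_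
  rw [inter_comm B, inter_comm Bᶜ, ← sdiff_eq, measure_inter_add_sdiff _ hB, Real.volume_Ioo]
  congr 1
  ring

theorem volume_Ioo_neg_half (a : ℝ) :
    volume (Ioo (-(a / 2)) (a / 2)) = ENNReal.ofReal a := by
  rw [Real.volume_Ioo]
  congr 1
  ring

/-- The overlaps with `B` and `Bᶜ` add up to a quantity depending only on `volume A` and `ρ`, so the
Riesz inequality reverses. The overlap with `B` is finite and can be cancelled. -/
theorem overlap_compl_Ioo_le {A B : Set ℝ} (hA : MeasurableSet A) (hB : MeasurableSet B)
    {a b : ℝ} (ha : 0 ≤ a) (hAa : volume A = ENNReal.ofReal a)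
    (hBb : volume B = ENNReal.ofReal b) (ρ : ℝ) :
    overlap (Ioo (-(a / 2)) (a / 2)) (Ioo (-(b / 2)) (b / 2))ᶜ ρ ≤ overlap A Bᶜ ρ := by
  have h1 := overlap_add_overlap_compl hA hB ρ
  have h2 := overlap_add_overlap_compl (A := Ioo (-(a / 2)) (a / 2))
    (B := Ioo (-(b / 2)) (b / 2)) measurableSet_Ioo measurableSet_Ioo ρ
  rw [volume_Ioo_neg_half, ← hAa, ← h1] at h2
  have h3 := overlap_le_overlap_Ioo hA hB ha hAa hBb ρ
  have h4 : overlap A B ρ ≠ ⊤ := by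
    refine ne_top_of_le_ne_top ?_ (overlap_le_mul ρ)
    rw [hAa, hBb]
    exact ENNReal.mul_ne_top ENNReal.ofReal_ne_top ENNReal.ofReal_ne_top
  rw [← ENNReal.add_le_add_iff_left h4]
  calc _ ≤ _ := add_le_add_left h3 _
    _ = _ := h2

/-- For `a + b ≤ 2 * ρ` all pairs of points of the centered intervals are within `ρ`. Equality thus
makes the overlap of `A` and `B` fill the whole product `A ×ˢ B` up to a null set. -/
theorem ae_abs_sub_lt_of_overlap_compl_eq {A B : Set ℝ} (hA : MeasurableSet A)
    (hB : MeasurableSet B) {a b : ℝ} (hAa : volume A = ENNReal.ofReal a)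
    (hBb : volume B = ENNReal.ofReal b) {ρ : ℝ} (hρ : a + b ≤ 2 * ρ)
    (h : overlap A Bᶜ ρ = overlap (Ioo (-(a / 2)) (a / 2)) (Ioo (-(b / 2)) (b / 2))ᶜ ρ) :
    ∀ᵐ z : ℝ × ℝ, z.1 ∈ A → z.2 ∈ B → |z.1 - z.2| < ρ := by
  have h1 := overlap_add_overlap_compl hA hB ρ
  have h2 := overlap_add_overlap_compl (A := Ioo (-(a / 2)) (a / 2))
    (B := Ioo (-(b / 2)) (b / 2)) measurableSet_Ioo measurableSet_Ioo ρ
  have hfin : volume A * ENNReal.ofReal (2 * ρ) ≠ ⊤ := by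
    rw [hAa]; exact ENNReal.mul_ne_top ENNReal.ofReal_ne_top ENNReal.ofReal_ne_top
  have h4 : overlap A Bᶜ ρ ≠ ⊤ := ne_top_of_le_ne_top hfin (h1 ▸ le_add_self)
  rw [volume_Ioo_neg_half, ← hAa, ← h1, ← h] at h2
  have h3 := (ENNReal.add_left_inj h4).1 h2
  have h5 : volume (A ×ˢ B) ≤ overlap A B ρ := by
    rw [← h3, Measure.volume_eq_prod, Measure.prod_prod, hAa, hBb]
    exact overlap_Ioo_of_large hρ
  have h6 : {z : ℝ × ℝ | z.1 ∈ A ∧ z.2 ∈ B ∧ |z.1 - z.2| < ρ} =ᵐ[volume] (A ×ˢ B) := by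
    refine ae_eq_of_subset_of_measure_ge (fun z hz => ⟨hz.1, hz.2.1⟩) h5
      (measurableSet_overlap hA hB ρ).nullMeasurableSet ?_
    rw [Measure.volume_eq_prod, Measure.prod_prod, hAa, hBb]
    exact ENNReal.mul_ne_top ENNReal.ofReal_ne_top ENNReal.ofReal_ne_top
  filter_upwards [h6] with z hz hz1 hz2
  exact (hz.to_iff.2 ⟨hz1, hz2⟩).2.2

/-- A set of finite measure which is essentially contained in an interval of the same measure. -/
theorem ae_eq_Ioo_of_ae_mem_Icc {A : Set ℝ} (hA : MeasurableSet A) {x y : ℝ}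
    (hA1 : ∀ᵐ t, t ∈ A → t ∈ Icc x y) (hA2 : ENNReal.ofReal (y - x) ≤ volume A) :
    A =ᵐ[volume] Ioo x y := by
  have h1 : (A ∩ Icc x y : Set ℝ) =ᵐ[volume] A := by
    filter_upwards [hA1] with t ht
    exact propext ⟨fun h => h.1, fun h => ⟨h, ht h⟩⟩
  have h2 : (A ∩ Icc x y : Set ℝ) =ᵐ[volume] Icc x y := by
    refine ae_eq_of_subset_of_measure_ge inter_subset_right ?_
      (hA.inter measurableSet_Icc).nullMeasurableSet (by simp)
    rw [measure_congr h1, Real.volume_Icc]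
    exact hA2
  exact h1.symm.trans (h2.trans Ioo_ae_eq_Icc.symm)

/-- Two non-null sets whose points have distance at most half the sum of their measures are
concentric intervals. -/
theorem concentric_of_ae_abs_sub_le {A B : Set ℝ} (hA : MeasurableSet A) (hB : MeasurableSet B)
    {a b : ℝ} (ha : 0 < a) (hb : 0 < b) (hAa : volume A = ENNReal.ofReal a)
    (hBb : volume B = ENNReal.ofReal b)
    (h : ∀ᵐ z : ℝ × ℝ, z.1 ∈ A → z.2 ∈ B → |z.1 - z.2| ≤ (a + b) / 2) :
    ∃ c, A =ᵐ[volume] Ioo (c - a / 2) (c + a / 2) ∧ B =ᵐ[volume] Ioo (c - b / 2) (c + b / 2) := by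
  set R := (a + b) / 2 with hR
  have hA0 : volume.restrict A ≠ 0 := by
    rw [Ne, Measure.restrict_eq_zero, hAa]; simpa using ha
  have hB0 : volume.restrict B ≠ 0 := by
    rw [Ne, Measure.restrict_eq_zero, hBb]; simpa using hb
  have hneA : (ae (volume.restrict A)).NeBot := ae_neBot.2 hA0
  have hneB : (ae (volume.restrict B)).NeBot := ae_neBot.2 hB0
  have h1 : ∀ᵐ t ∂volume.restrict A, ∀ᵐ u ∂volume.restrict B, |t - u| ≤ R := by
    rw [ae_restrict_iff' hA]
    rw [Measure.volume_eq_prod] at h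
    filter_upwards [Measure.ae_ae_of_ae_prod h] with t ht htA
    rw [ae_restrict_iff' hB]
    filter_upwards [ht] with u hu using hu htA
  have h2 : ∀ᵐ u ∂volume.restrict B, ∀ᵐ t ∂volume.restrict A, |t - u| ≤ R := by
    rw [ae_restrict_iff' hB]
    rw [Measure.volume_eq_prod, ← Measure.prod_swap,
      ae_map_iff measurable_swap.aemeasurable] at h
    · filter_upwards [Measure.ae_ae_of_ae_prod h] with u hu huB
      rw [ae_restrict_iff' hA]
      filter_upwards [hu] with t ht htA using ht htA huB
    · exact ((measurable_fst hA).compl.union ((measurable_snd hB).compl.union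
        (measurableSet_le (f := fun z : ℝ × ℝ => |z.1 - z.2|) (g := fun _ => R)
          (by fun_prop) (by fun_prop)))).congr (by
            ext z
            simp only [mem_union, mem_compl_iff, mem_preimage, mem_ofPred_eq]
            tauto)
  obtain ⟨t0, ht0⟩ := h1.exists
  obtain ⟨u0, hu0⟩ := h2.exists
  have bB1 : Filter.IsBoundedUnder (· ≤ ·) (ae (volume.restrict B)) (id : ℝ → ℝ) :=
    ⟨t0 + R, by
      rw [Filter.eventually_map]
      filter_upwards [ht0] with u hu using by have := (abs_le.1 hu).1; simp only [id]; linarith⟩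
  have bB2 : Filter.IsBoundedUnder (· ≥ ·) (ae (volume.restrict B)) (id : ℝ → ℝ) :=
    ⟨t0 - R, by
      rw [Filter.eventually_map]
      filter_upwards [ht0] with u hu using by have := (abs_le.1 hu).2; simp only [id]; linarith⟩
  have bA1 : Filter.IsBoundedUnder (· ≤ ·) (ae (volume.restrict A)) (id : ℝ → ℝ) :=
    ⟨u0 + R, by
      rw [Filter.eventually_map]
      filter_upwards [hu0] with t hu using by have := (abs_le.1 hu).2; simp only [id]; linarith⟩
  have bA2 : Filter.IsBoundedUnder (· ≥ ·) (ae (volume.restrict A)) (id : ℝ → ℝ) :=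
    ⟨u0 - R, by
      rw [Filter.eventually_map]
      filter_upwards [hu0] with t hu using by have := (abs_le.1 hu).1; simp only [id]; linarith⟩
  have kB1 := ae_le_essSup bB1
  have kB2 := ae_essInf_le bB2
  have kA1 := ae_le_essSup bA1
  have kA2 := ae_essInf_le bA2
  set α1 := essInf (id : ℝ → ℝ) (volume.restrict A)
  set α2 := essSup (id : ℝ → ℝ) (volume.restrict A)
  set β1 := essInf (id : ℝ → ℝ) (volume.restrict B)
  set β2 := essSup (id : ℝ → ℝ) (volume.restrict B)
  -- Adding `α2 - β1 ≤ R` and `β2 - α1 ≤ R` bounds the two essential spans by `2 * R = a + b`. They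
  -- are at least `a` and `b`, so all these inequalities are equalities and the midpoints agree.
  have i1 : α2 ≤ β1 + R := by
    refine essSup_le_of_ae_le _ ?_ bA2.isCoboundedUnder_le
    filter_upwards [h1] with t ht
    have : t - R ≤ β1 := by
      refine le_essInf_of_ae_le _ ?_ bB1.isCoboundedUnder_ge
      filter_upwards [ht] with u hu
      have := (abs_le.1 hu).2
      simp only [id]; linarith
    simp only [id]; linarith
  have i2 : β2 - R ≤ α1 := by
    refine le_essInf_of_ae_le _ ?_ bA1.isCoboundedUnder_ge
    filter_upwards [h1] with t ht
    have : β2 ≤ t + R := by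
      refine essSup_le_of_ae_le _ ?_ bB2.isCoboundedUnder_le
      filter_upwards [ht] with u hu
      have := (abs_le.1 hu).1
      simp only [id]; linarith
    simp only [id]; linarith
  rw [ae_restrict_iff' hA] at kA1 kA2
  rw [ae_restrict_iff' hB] at kB1 kB2
  have mA : ∀ᵐ t, t ∈ A → t ∈ Icc α1 α2 := by
    filter_upwards [kA1, kA2] with t h1 h2 h3 using ⟨h2 h3, h1 h3⟩
  have mB : ∀ᵐ t, t ∈ B → t ∈ Icc β1 β2 := by
    filter_upwards [kB1, kB2] with t h1 h2 h3 using ⟨h2 h3, h1 h3⟩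
  have lA : a ≤ α2 - α1 := by
    have := measure_mono_ae (μ := volume) (s := A) (t := Icc α1 α2) mA
    rw [hAa, Real.volume_Icc, ENNReal.ofReal_le_ofReal_iff'] at this
    exact this.resolve_right (not_le.2 ha)
  have lB : b ≤ β2 - β1 := by
    have := measure_mono_ae (μ := volume) (s := B) (t := Icc β1 β2) mB
    rw [hBb, Real.volume_Icc, ENNReal.ofReal_le_ofReal_iff'] at this
    exact this.resolve_right (not_le.2 hb)
  refine ⟨(α1 + α2) / 2, ?_, ?_⟩
  · have e1 : (α1 + α2) / 2 - a / 2 = α1 := by linarith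
    have e2 : (α1 + α2) / 2 + a / 2 = α2 := by linarith
    rw [e1, e2]
    exact ae_eq_Ioo_of_ae_mem_Icc hA mA (by rw [hAa]; exact ENNReal.ofReal_le_ofReal (by linarith))
  · have e1 : (α1 + α2) / 2 - b / 2 = β1 := by linarith
    have e2 : (α1 + α2) / 2 + b / 2 = β2 := by linarith
    rw [e1, e2]
    exact ae_eq_Ioo_of_ae_mem_Icc hB mB (by rw [hBb]; exact ENNReal.ofReal_le_ofReal (by linarith))

/-- Radii just above the threshold `(a + b) / 2` are enough: along a sequence decreasing to it, the
almost sure distance bounds pass to the limit. -/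
theorem concentric_of_overlap_compl_eq {A B : Set ℝ} (hA : MeasurableSet A)
    (hB : MeasurableSet B) {a b : ℝ} (ha : 0 < a) (hb : 0 < b) (hAa : volume A = ENNReal.ofReal a)
    (hBb : volume B = ENNReal.ofReal b)
    (h : ∀ ε > 0, ∃ ρ, (a + b) / 2 ≤ ρ ∧ ρ ≤ (a + b) / 2 + ε ∧
      overlap A Bᶜ ρ = overlap (Ioo (-(a / 2)) (a / 2)) (Ioo (-(b / 2)) (b / 2))ᶜ ρ) :
    ∃ c, A =ᵐ[volume] Ioo (c - a / 2) (c + a / 2) ∧ B =ᵐ[volume] Ioo (c - b / 2) (c + b / 2) := by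
  refine concentric_of_ae_abs_sub_le hA hB ha hb hAa hBb ?_
  have h1 : ∀ n : ℕ, ∀ᵐ z : ℝ × ℝ, z.1 ∈ A → z.2 ∈ B →
      |z.1 - z.2| ≤ (a + b) / 2 + 1 / ((n : ℝ) + 1) := by
    intro n
    obtain ⟨ρ, h1, h2, h3⟩ := h (1 / ((n : ℝ) + 1)) Nat.one_div_pos_of_nat
    filter_upwards [ae_abs_sub_lt_of_overlap_compl_eq hA hB hAa hBb (by linarith) h3]
      with z hz hz1 hz2 using (hz hz1 hz2).le.trans h2
  filter_upwards [ae_all_iff.2 h1] with z hz hz1 hz2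
  refine le_of_forall_pos_le_add fun ε hε => ?_
  obtain ⟨n, hn⟩ := exists_nat_one_div_lt hε
  exact (hz n hz1 hz2).trans (by linarith)

/-- The overlap deficit does not change under a simultaneous translation. -/
theorem overlap_compl_translate (c a b ρ : ℝ) :
    overlap (Ioo (c - a / 2) (c + a / 2)) (Ioo (c - b / 2) (c + b / 2))ᶜ ρ =
      overlap (Ioo (-(a / 2)) (a / 2)) (Ioo (-(b / 2)) (b / 2))ᶜ ρ := by
  have := measure_preimage_add_right (volume : Measure (ℝ × ℝ)) (c, c)
    {z : ℝ × ℝ | z.1 ∈ Ioo (c - a / 2) (c + a / 2) ∧ z.2 ∈ (Ioo (c - b / 2) (c + b / 2))ᶜ ∧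
      |z.1 - z.2| < ρ}
  rw [overlap, ← this, overlap]
  congr 1
  ext z
  have e1 : z.1 + c ∈ Ioo (c - a / 2) (c + a / 2) ↔ z.1 ∈ Ioo (-(a / 2)) (a / 2) := by
    simp only [mem_Ioo]; constructor <;> rintro ⟨_, _⟩ <;> constructor <;> linarith
  have e2 : z.2 + c ∈ Ioo (c - b / 2) (c + b / 2) ↔ z.2 ∈ Ioo (-(b / 2)) (b / 2) := by
    simp only [mem_Ioo]; constructor <;> rintro ⟨_, _⟩ <;> constructor <;> linarith
  simp only [mem_preimage, mem_ofPred_eq, Prod.fst_add, Prod.snd_add, add_sub_add_right_eq_sub,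
    mem_compl_iff, e1, e2]

/-! ### Symmetrization on the line and slice by slice -/

theorem schwarzSymm_eq_Ioo {A : Set ℝ} {a : ℝ} (hA : volume A = ENNReal.ofReal a) :
    schwarzSymm A = Ioo (-(a / 2)) (a / 2) := by
  ext t
  rw [schwarzSymm, mem_ofPred_eq, hA, ENNReal.ofReal_lt_ofReal_iff_of_nonneg (by positivity),
    mem_Ioo, ← abs_lt, lt_div_iff₀ two_pos, mul_comm]

/-- The symmetrization of a function on the line. -/
noncomputable def lineSymm (g : ℝ → ℝ) (t : ℝ) : ℝ :=
  sSup {τ : ℝ | 0 < τ ∧ t ∈ schwarzSymm {y | g y > τ}}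

theorem lineSymm_nonneg (g : ℝ → ℝ) (t : ℝ) : 0 ≤ lineSymm g t :=
  Real.sSup_nonneg fun _ hτ => hτ.1.le

theorem lineSymm_congr {g h : ℝ → ℝ} (H : g =ᵐ[volume] h) : lineSymm g = lineSymm h := by
  funext t
  have : ∀ τ, volume {y | g y > τ} = volume {y | h y > τ} := fun τ => measure_congr <| by
    filter_upwards [H] with y hy
    exact propext (by change g y > τ ↔ h y > τ; rw [hy])
  simp only [lineSymm, schwarzSymm, this]

theorem lineSymm_posPart (g : ℝ → ℝ) : lineSymm (fun t => max (g t) 0) = lineSymm g := by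
  funext t
  unfold lineSymm
  congr 1
  ext τ
  simp only [mem_ofPred_eq, and_congr_right_iff]
  intro hτ
  have : {y | max (g y) 0 > τ} = {y | g y > τ} := by
    ext y
    simp [not_lt.2 hτ.le]
  rw [this]

theorem schwarzSymm_superlevel_anti (g : ℝ → ℝ) {σ τ : ℝ} (h : σ ≤ τ) :
    schwarzSymm {y | g y > τ} ⊆ schwarzSymm {y | g y > σ} := fun _ ht =>
  lt_of_lt_of_le ht (measure_mono fun _ hy => lt_of_le_of_lt h hy)

/-- Right continuity of the distribution function: the superlevel set at `τ` is the increasing union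
of those at `τ + 1 / (n + 1)`. -/
theorem exists_gt_of_lt_measure_superlevel {α : Type*} [MeasurableSpace α] {μ : Measure α}
    (g : α → ℝ) {τ : ℝ} {c : ENNReal} (h : c < μ {y | g y > τ}) :
    ∃ τ' > τ, c < μ {y | g y > τ'} := by
  have h1 : {y | g y > τ} = ⋃ n : ℕ, {y | g y > τ + 1 / ((n : ℝ) + 1)} := by
    ext y
    simp only [mem_ofPred_eq, mem_iUnion]
    constructor
    · intro hy
      obtain ⟨n, hn⟩ := exists_nat_one_div_lt (sub_pos.2 hy)
      exact ⟨n, by linarith⟩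
    · rintro ⟨n, hn⟩
      have : 0 < 1 / ((n : ℝ) + 1) := Nat.one_div_pos_of_nat
      linarith
  have hmono : Monotone fun n : ℕ => {y | g y > τ + 1 / ((n : ℝ) + 1)} := by
    intro n k hnk y hy
    have h2 : 1 / ((k : ℝ) + 1) ≤ 1 / ((n : ℝ) + 1) := Nat.one_div_le_one_div hnk
    simp only [mem_ofPred_eq] at hy ⊢
    linarith
  rw [h1, hmono.measure_iUnion, lt_iSup_iff] at h
  obtain ⟨n, hn⟩ := h
  have : 0 < 1 / ((n : ℝ) + 1) := Nat.one_div_pos_of_nat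
  exact ⟨_, by linarith, hn⟩

/-- The distribution function tends to `0`, hence eventually drops below `2 * |t|`. At `t = 0` this
fails for unbounded `g`, and `sSup` would then take its default value `0`. -/
theorem bddAbove_lineSymm_levels {g : ℝ → ℝ} (hg : Measurable g)
    (hfin : ∀ τ > 0, volume {y | g y > τ} ≠ ⊤) {t : ℝ} (ht : t ≠ 0) :
    BddAbove {τ : ℝ | 0 < τ ∧ t ∈ schwarzSymm {y | g y > τ}} := by
  have h1 : Filter.Tendsto (fun n : ℕ => volume {y | g y > (n : ℝ) + 1}) Filter.atTop (nhds 0) := by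
    have h2 : ⋂ n : ℕ, {y | g y > (n : ℝ) + 1} = ∅ := by
      ext y
      simp only [mem_iInter, mem_ofPred_eq, mem_empty_iff_false, iff_false, not_forall, not_lt]
      obtain ⟨n, hn⟩ := exists_nat_ge (g y)
      exact ⟨n, by linarith⟩
    rw [← measure_empty (μ := (volume : Measure ℝ)), ← h2]
    refine tendsto_measure_iInter_atTop
      (fun n => (measurableSet_lt measurable_const hg).nullMeasurableSet) ?_ ⟨0, hfin _ (by simp)⟩
    intro n k hnk y hy
    have h3 : (n : ℝ) ≤ k := Nat.cast_le.2 hnk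
    simp only [mem_ofPred_eq] at hy ⊢
    linarith
  have h4 : (0 : ENNReal) < ENNReal.ofReal (2 * |t|) := by simpa using ht
  obtain ⟨n, hn⟩ := (h1.eventually_lt_const h4).exists
  refine ⟨(n : ℝ) + 1, fun τ hτ => ?_⟩
  by_contra! hlt
  have h5 : ENNReal.ofReal (2 * |t|) < volume {y | g y > (n : ℝ) + 1} :=
    schwarzSymm_superlevel_anti g hlt.le hτ.2
  exact lt_asymm hn h5

theorem lt_lineSymm_iff {g : ℝ → ℝ} (hg : Measurable g)
    (hfin : ∀ τ > 0, volume {y | g y > τ} ≠ ⊤) {t τ : ℝ} (ht : t ≠ 0) (hτ : 0 < τ) :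
    τ < lineSymm g t ↔ t ∈ schwarzSymm {y | g y > τ} := by
  constructor
  · intro h
    have hne : {τ : ℝ | 0 < τ ∧ t ∈ schwarzSymm {y | g y > τ}}.Nonempty := by
      by_contra hne
      rw [not_nonempty_iff_eq_empty] at hne
      rw [lineSymm, hne, Real.sSup_empty] at h
      exact lt_asymm h hτ
    obtain ⟨τ', h1, h2⟩ := exists_lt_of_lt_csSup hne h
    exact schwarzSymm_superlevel_anti g h2.le h1.2
  · intro h
    obtain ⟨τ', h1, h2⟩ := exists_gt_of_lt_measure_superlevel g h
    exact lt_of_lt_of_le h1 (le_csSup (bddAbove_lineSymm_levels hg hfin ht) ⟨hτ.trans h1, h2⟩)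

/-- `G` has, slice by slice, the symmetrized superlevel sets of `F`. -/
def IsSliceSymm {X : Type*} (F G : X → ℝ → ℝ) : Prop :=
  ∀ x, ∀ τ > 0, {t | G x t > τ} =ᵐ[volume] schwarzSymm {t | F x t > τ}

/-- The slicewise symmetrization, set to `0` on the symmetry hyperplane. -/
noncomputable def sliceSymm {X : Type*} (F : X → ℝ → ℝ) (x : X) (t : ℝ) : ℝ :=
  if t = 0 then 0 else lineSymm (F x) t

theorem sliceSymm_nonneg {X : Type*} (F : X → ℝ → ℝ) (x : X) (t : ℝ) : 0 ≤ sliceSymm F x t := by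
  unfold sliceSymm
  split_ifs
  · exact le_rfl
  · exact lineSymm_nonneg _ _

section SliceSymmetrization

variable {X : Type*} [MeasurableSpace X]

theorem lt_sliceSymm_iff {F : X → ℝ → ℝ} (hF : Measurable (Function.uncurry F))
    (hfin : ∀ x, ∀ τ > 0, volume {t | F x t > τ} ≠ ⊤) {τ : ℝ} (hτ : 0 < τ) (x : X) (t : ℝ) :
    τ < sliceSymm F x t ↔ t ≠ 0 ∧ t ∈ schwarzSymm {y | F x y > τ} := by
  unfold sliceSymm
  split_ifs with h
  · simp [h, hτ.le]
  · rw [lt_lineSymm_iff (hF.of_uncurry_left (x := x)) (hfin x) h hτ]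
    simp [h]

theorem isSliceSymm_sliceSymm {F : X → ℝ → ℝ} (hF : Measurable (Function.uncurry F))
    (hfin : ∀ x, ∀ τ > 0, volume {t | F x t > τ} ≠ ⊤) : IsSliceSymm F (sliceSymm F) := by
  intro x τ hτ
  have h0 : ∀ᵐ t : ℝ, t ≠ 0 := by simp [ae_iff]
  filter_upwards [h0] with t ht
  refine propext ((lt_sliceSymm_iff hF hfin hτ x t).trans ?_)
  simp only [ht, ne_eq, not_false_eq_true, true_and]
  rfl

theorem measurable_sliceSymm {F : X → ℝ → ℝ} (hF : Measurable (Function.uncurry F))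
    (hfin : ∀ x, ∀ τ > 0, volume {t | F x t > τ} ≠ ⊤) :
    Measurable (Function.uncurry (sliceSymm F)) := by
  have hpos : ∀ τ > 0, MeasurableSet {z : X × ℝ | τ < sliceSymm F z.1 z.2} := by
    intro τ hτ
    have h1 : MeasurableSet {w : (X × ℝ) × ℝ | τ < F w.1.1 w.2} :=
      measurableSet_lt measurable_const
        (hF.comp (g := Function.uncurry F) (f := fun w : (X × ℝ) × ℝ => (w.1.1, w.2)) (by fun_prop))
    have h2 : Measurable fun z : X × ℝ => volume {t | F z.1 t > τ} :=
      measurable_measure_prodMk_left h1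
    have h3 : {z : X × ℝ | τ < sliceSymm F z.1 z.2} = {z : X × ℝ | z.2 ≠ 0} ∩
        {z | ENNReal.ofReal (2 * |z.2|) < volume {t | F z.1 t > τ}} := by
      ext z
      exact lt_sliceSymm_iff hF hfin hτ z.1 z.2
    rw [h3]
    exact (measurable_snd (measurableSet_singleton (0 : ℝ)).compl).inter
      (measurableSet_lt (by fun_prop) h2)
  refine measurable_of_Ioi fun c => ?_
  rcases lt_or_ge c 0 with hc | hc
  · convert MeasurableSet.univ
    ext z
    simp only [mem_preimage, mem_Ioi, mem_univ, iff_true]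
    exact hc.trans_le (sliceSymm_nonneg F z.1 z.2)
  -- The description of superlevel sets needs a positive level, so `c = 0` is reached as a countable
  -- union.
  · have : Function.uncurry (sliceSymm F) ⁻¹' Ioi c =
        ⋃ n : ℕ, {z : X × ℝ | c + 1 / ((n : ℝ) + 1) < sliceSymm F z.1 z.2} := by
      ext z
      simp only [mem_preimage, mem_Ioi, mem_iUnion, mem_ofPred_eq, Function.uncurry]
      constructor
      · intro h
        obtain ⟨n, hn⟩ := exists_nat_one_div_lt (sub_pos.2 h)
        exact ⟨n, by linarith⟩
      · rintro ⟨n, hn⟩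
        have : 0 < 1 / ((n : ℝ) + 1) := Nat.one_div_pos_of_nat
        linarith
    rw [this]
    refine MeasurableSet.iUnion fun n => hpos _ ?_
    have : 0 < 1 / ((n : ℝ) + 1) := Nat.one_div_pos_of_nat
    linarith

end SliceSymmetrization

theorem volume_superlevel_eq_of_isSliceSymm {X : Type*} {F G : X → ℝ → ℝ} (h : IsSliceSymm F G)
    (hfin : ∀ x, ∀ τ > 0, volume {t | F x t > τ} ≠ ⊤) (x : X) {τ : ℝ} (hτ : 0 < τ) :
    volume {t | G x t > τ} = volume {t | F x t > τ} := by
  rw [measure_congr (h x τ hτ), schwarzSymm_eq_Ioo (ENNReal.ofReal_toReal (hfin x τ hτ)).symm,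
    volume_Ioo_neg_half, ENNReal.ofReal_toReal (hfin x τ hτ)]

/-- Equimeasurable functions have the same layer cake integral; this gives `f^# ∈ L^p`. -/
theorem lintegral_rpow_eq_of_isSliceSymm {X : Type*} {F G : X → ℝ → ℝ} (h : IsSliceSymm F G)
    (hfin : ∀ x, ∀ τ > 0, volume {t | F x t > τ} ≠ ⊤) (x : X) (hF : Measurable (F x))
    (hG : Measurable (G x)) (hF0 : ∀ t, 0 ≤ F x t) (hG0 : ∀ t, 0 ≤ G x t) {p : ℝ} (hp : 0 < p) :
    ∫⁻ t, ENNReal.ofReal (G x t ^ p) = ∫⁻ t, ENNReal.ofReal (F x t ^ p) := by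
  rw [lintegral_rpow_eq_lintegral_meas_lt_mul volume (Filter.Eventually.of_forall hF0)
    hF.aemeasurable hp, lintegral_rpow_eq_lintegral_meas_lt_mul volume
    (Filter.Eventually.of_forall hG0) hG.aemeasurable hp]
  congr 1
  refine setLIntegral_congr_fun measurableSet_Ioi fun τ hτ => ?_
  have := volume_superlevel_eq_of_isSliceSymm h hfin x hτ
  simp only [gt_iff_lt] at this
  simp only [this]

/-! ### Layer cake measures for the kernel and for the power -/

/-- A measure on the tails `[n, ∞)` representing the kernel `n ^ (-q)`. -/
theorem exists_measure_Ioi_eq_rpow {q : ℝ} (hq : 0 < q) :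
    ∃ η : Measure ℝ, SFinite η ∧ (∀ n > 0, η (Ioi n) = ENNReal.ofReal (1 / n ^ q)) ∧
      volume.restrict (Ioi 0) ≪ η := by
  have hm : Measurable fun r : ℝ => ENNReal.ofReal (q * r ^ (-q - 1)) := by fun_prop
  -- The density is minus the derivative of `r ^ (-q)`. Its positivity gives the absolute continuity
  -- that later turns `η`-almost every `r` into Lebesgue-almost every `r > 0`.
  refine ⟨(volume.restrict (Ioi 0)).withDensity fun r => ENNReal.ofReal (q * r ^ (-q - 1)),
    inferInstance, fun n hn => ?_, ?_⟩
  · rw [withDensity_apply _ measurableSet_Ioi, Measure.restrict_restrict measurableSet_Ioi,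
      inter_eq_left.2 (Ioi_subset_Ioi hn.le), ← ofReal_integral_eq_lintegral_ofReal]
    · rw [integral_const_mul, integral_Ioi_rpow_of_lt (by linarith) hn]
      congr 1
      rw [show -q - 1 + 1 = -q by ring, Real.rpow_neg hn.le]
      field_simp
    · exact (integrableOn_Ioi_rpow_of_lt (by linarith) hn).const_mul q
    · refine (ae_restrict_iff' measurableSet_Ioi).2 (Filter.Eventually.of_forall fun r hr => ?_)
      exact mul_nonneg hq.le (Real.rpow_nonneg (hn.trans hr).le _)
  · refine withDensity_absolutelyContinuous' hm.aemeasurable ?_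
    refine (ae_restrict_iff' measurableSet_Ioi).2 (Filter.Eventually.of_forall fun r hr => ?_)
    rw [Ne, ENNReal.ofReal_eq_zero, not_le]
    exact mul_pos hq (Real.rpow_pos_of_pos hr _)

/-- Taylor's formula with integral remainder for `d ^ p` at `0`; the singularity `h ^ (p - 2)` is
integrable because `p > 1`. -/
theorem integral_sub_mul_rpow {p d : ℝ} (hp : 1 < p) (hd : 0 ≤ d) :
    ∫ h in (0 : ℝ)..d, p * (p - 1) * h ^ (p - 2) * (d - h) = d ^ p := by
  have e : ∀ h ∈ uIcc (0 : ℝ) d, p * (p - 1) * h ^ (p - 2) * (d - h) =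
      p * (p - 1) * d * h ^ (p - 2) - p * (p - 1) * h ^ (p - 1) := by
    intro h hh
    rw [uIcc_of_le hd] at hh
    rcases hh.1.eq_or_lt with rfl | h0
    · rw [Real.zero_rpow (by linarith : p - 1 ≠ 0)]
      ring
    · rw [show p - 1 = (p - 2) + 1 by ring, Real.rpow_add_one h0.ne']
      ring
  rw [intervalIntegral.integral_congr e, intervalIntegral.integral_sub
    ((intervalIntegral.intervalIntegrable_rpow' (by linarith)).const_mul _)
    ((intervalIntegral.intervalIntegrable_rpow' (by linarith)).const_mul _),
    intervalIntegral.integral_const_mul, intervalIntegral.integral_const_mul,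
    integral_rpow (Or.inl (by linarith)), integral_rpow (Or.inl (by linarith))]
  rw [show p - 2 + 1 = p - 1 by ring, show p - 1 + 1 = p by ring,
    Real.zero_rpow (by linarith : p - 1 ≠ 0), Real.zero_rpow (by linarith : p ≠ 0)]
  have h1 : p - 1 ≠ 0 := by linarith
  have h2 : p ≠ 0 := by linarith
  have h3 : d * d ^ (p - 1) = d ^ p := by
    rcases hd.eq_or_lt with rfl | h0
    · rw [Real.zero_rpow h2, zero_mul]
    · rw [mul_comm, ← Real.rpow_add_one h0.ne']; congr 1; ring
  field_simp
  rw [sub_zero, sub_zero, ← h3]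
  ring

/-- A measure representing `d ^ p` as a superposition of the functions `d ↦ (d - h)⁺`. -/
theorem exists_measure_lintegral_sub_eq_rpow {p : ℝ} (hp : 1 ≤ p) :
    ∃ ν : Measure ℝ, SFinite ν ∧ (∀ᵐ h ∂ν, 0 ≤ h) ∧
      (∀ d ≥ 0, ∫⁻ h, ENNReal.ofReal (d - h) ∂ν = ENNReal.ofReal (d ^ p)) ∧
      (p = 1 → ν = Measure.dirac 0) ∧ (1 < p → volume.restrict (Ioi 0) ≪ ν) := by
  rcases hp.eq_or_lt with rfl | hp
  · refine ⟨Measure.dirac 0, inferInstance, ?_, fun d _ => ?_, fun _ => rfl,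
      fun h => absurd h (lt_irrefl _)⟩
    · rw [ae_dirac_eq]; exact le_refl (0 : ℝ)
    · rw [lintegral_dirac]; simp
  · have hm : Measurable fun r : ℝ => ENNReal.ofReal (p * (p - 1) * r ^ (p - 2)) := by fun_prop
    have hnn : ∀ h : ℝ, 0 ≤ h → 0 ≤ p * (p - 1) * h ^ (p - 2) := fun h hh =>
      mul_nonneg (mul_nonneg (by linarith) (by linarith)) (Real.rpow_nonneg hh _)
    refine ⟨(volume.restrict (Ioi 0)).withDensity fun r => ENNReal.ofReal (p * (p - 1) * r ^ (p - 2)),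
      inferInstance, ?_, fun d hd => ?_, fun h => absurd h hp.ne', fun _ => ?_⟩
    · refine (withDensity_absolutelyContinuous _ _).ae_le ?_
      exact (ae_restrict_iff' measurableSet_Ioi).2 (Filter.Eventually.of_forall fun r hr => le_of_lt hr)
    · rw [lintegral_withDensity_eq_lintegral_mul _ hm (by fun_prop)]
      have e1 : ∫⁻ h in Ioi 0, ((fun r : ℝ => ENNReal.ofReal (p * (p - 1) * r ^ (p - 2))) *
          fun h => ENNReal.ofReal (d - h)) h =
          ∫⁻ h in Ioc 0 d, ENNReal.ofReal (p * (p - 1) * h ^ (p - 2) * (d - h)) := by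
        rw [← lintegral_indicator measurableSet_Ioi, ← lintegral_indicator measurableSet_Ioc]
        refine lintegral_congr fun h => ?_
        by_cases h0 : 0 < h
        · rw [indicator_of_mem (show h ∈ Ioi 0 from h0), Pi.mul_apply,
            ← ENNReal.ofReal_mul (hnn h h0.le)]
          by_cases h1 : h ≤ d
          · rw [indicator_of_mem (show h ∈ Ioc 0 d from ⟨h0, h1⟩)]
          · rw [indicator_of_notMem (fun h2 => h1 h2.2), ENNReal.ofReal_eq_zero]
            exact mul_nonpos_of_nonneg_of_nonpos (hnn h h0.le) (by linarith)
        · rw [indicator_of_notMem (show h ∉ Ioi 0 from h0),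
            indicator_of_notMem (show h ∉ Ioc 0 d from fun h2 => h0 h2.1)]
      rw [e1, ← integral_sub_mul_rpow hp hd, intervalIntegral.integral_of_le hd,
        ofReal_integral_eq_lintegral_ofReal]
      · rw [← IntegrableOn, ← intervalIntegrable_iff_integrableOn_Ioc_of_le hd]
        exact ((intervalIntegral.intervalIntegrable_rpow' (by linarith)).const_mul _).mul_continuousOn
          (by fun_prop)
      · refine (ae_restrict_iff' measurableSet_Ioc).2 (Filter.Eventually.of_forall fun h hh => ?_)
        exact mul_nonneg (hnn h hh.1.le) (by linarith [hh.2])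
    · refine withDensity_absolutelyContinuous' hm.aemeasurable ?_
      refine (ae_restrict_iff' measurableSet_Ioi).2 (Filter.Eventually.of_forall fun r hr => ?_)
      rw [Ne, ENNReal.ofReal_eq_zero, not_le]
      exact mul_pos (mul_pos (by linarith) (by linarith)) (Real.rpow_pos_of_pos hr _)

/-! ### The energy as an integral over pairs of level sets -/

section SliceEnergy

variable {X : Type*} [MeasurableSpace X]

/-- The fractional energy of a function on `X × ℝ` for a kernel depending on the two base points
and on the difference of the last coordinates. -/
noncomputable def sliceEnergy (μ : Measure X) (N : X → X → ℝ → ℝ) (q p : ℝ) (F : X → ℝ → ℝ) :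
    ENNReal :=
  ∫⁻ x, ∫⁻ y, ∫⁻ t, ∫⁻ u, ENNReal.ofReal (|F x t - F y u| ^ p / N x y (t - u) ^ q) ∂volume
    ∂volume ∂μ ∂μ

/-- Kernels whose sublevel sets in the last coordinate are centered open intervals. -/
structure IsSliceKernel (N : X → X → ℝ → ℝ) : Prop where
  measurable : Measurable fun z : (X × X) × ℝ => N z.1.1 z.1.2 z.2
  nonneg : ∀ x y t, 0 ≤ N x y t
  symm : ∀ x y t, N y x (-t) = N x y t
  eq_of_eq_zero : ∀ x y t, N x y t = 0 → x = y ∧ t = 0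
  sublevel : ∀ x y r, ∃ ρ, {t | N x y t < r} = Ioo (-ρ) ρ

/-- The pairs of heights at which `F` lies above `σ + h` over `x`, at most `σ` over `y`, and which
are close with respect to `N`. -/
def levelPairs (N : X → X → ℝ → ℝ) (F : X → ℝ → ℝ) (h σ : ℝ) (x y : X) (r : ℝ) : Set (ℝ × ℝ) :=
  {v | v.1 ∈ {t | F x t > σ + h} ∧ v.2 ∈ {t | F y t > σ}ᶜ ∧ N x y (v.1 - v.2) < r}

theorem volume_levelPairs {X : Type*} {N : X → X → ℝ → ℝ} (F : X → ℝ → ℝ) (h σ : ℝ) {x y : X} {r ρ : ℝ}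
    (hρ : {t | N x y t < r} = Ioo (-ρ) ρ) :
    volume (levelPairs N F h σ x y r) = overlap {t | F x t > σ + h} {t | F y t > σ}ᶜ ρ := by
  unfold levelPairs overlap
  congr 1
  ext v
  have : N x y (v.1 - v.2) < r ↔ |v.1 - v.2| < ρ := by
    rw [abs_lt]
    exact Set.ext_iff.1 hρ (v.1 - v.2)
  simp only [mem_ofPred_eq, this]

theorem measurableSet_levelPairs {N : X → X → ℝ → ℝ} (hN : IsSliceKernel N) {F : X → ℝ → ℝ}
    (hF : Measurable (Function.uncurry F)) :
    MeasurableSet {z : (((ℝ × ℝ) × (X × X)) × ℝ) × (ℝ × ℝ) |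
      z.2 ∈ levelPairs N F z.1.1.1.1 z.1.1.1.2 z.1.1.2.1 z.1.1.2.2 z.1.2} := by
  have m1 : Measurable fun z : (((ℝ × ℝ) × (X × X)) × ℝ) × (ℝ × ℝ) => F z.1.1.2.1 z.2.1 :=
    hF.comp (f := fun z : (((ℝ × ℝ) × (X × X)) × ℝ) × (ℝ × ℝ) => (z.1.1.2.1, z.2.1)) (by fun_prop)
  have m2 : Measurable fun z : (((ℝ × ℝ) × (X × X)) × ℝ) × (ℝ × ℝ) => F z.1.1.2.2 z.2.2 :=
    hF.comp (f := fun z : (((ℝ × ℝ) × (X × X)) × ℝ) × (ℝ × ℝ) => (z.1.1.2.2, z.2.2)) (by fun_prop)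
  have m3 : Measurable fun z : (((ℝ × ℝ) × (X × X)) × ℝ) × (ℝ × ℝ) =>
      N z.1.1.2.1 z.1.1.2.2 (z.2.1 - z.2.2) :=
    hN.measurable.comp (f := fun z : (((ℝ × ℝ) × (X × X)) × ℝ) × (ℝ × ℝ) =>
      ((z.1.1.2.1, z.1.1.2.2), z.2.1 - z.2.2)) (by fun_prop)
  exact (measurableSet_lt (f := fun z : (((ℝ × ℝ) × (X × X)) × ℝ) × (ℝ × ℝ) =>
      z.1.1.1.2 + z.1.1.1.1) (by fun_prop) m1).inter
    ((measurableSet_lt (f := fun z : (((ℝ × ℝ) × (X × X)) × ℝ) × (ℝ × ℝ) => z.1.1.1.2)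
      (by fun_prop) m2).compl.inter
    (measurableSet_lt (g := fun z : (((ℝ × ℝ) × (X × X)) × ℝ) × (ℝ × ℝ) => z.1.2) m3
      (by fun_prop)))

theorem volume_level_window {a b h : ℝ} (hb : 0 ≤ b) :
    volume {σ : ℝ | 0 < σ ∧ a > σ + h ∧ ¬ b > σ} = ENNReal.ofReal (a - b - h) := by
  have e : a - b - h = a - h - b := by ring
  refine le_antisymm ?_ ?_
  · calc _ ≤ volume (Ico b (a - h)) := measure_mono fun σ hσ => by
          rcases hσ with ⟨_, h2, h3⟩
          exact ⟨not_lt.1 h3, by linarith⟩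
      _ = _ := by rw [Real.volume_Ico, e]
  · calc _ = volume (Ioo b (a - h)) := by rw [Real.volume_Ioo, e]
      _ ≤ _ := measure_mono (show Ioo b (a - h) ⊆ {σ : ℝ | 0 < σ ∧ a > σ + h ∧ ¬ b > σ} from
          fun σ hσ => ⟨hb.trans_lt hσ.1, by linarith [hσ.2], not_lt.2 hσ.1.le⟩)

/-- The three layer cakes for a single pair of points with values `a`, `b` at distance `n`: `r`
yields `1 / n ^ q`, `σ` yields `(a - b - h)⁺`, and `h` yields the power. -/
theorem lintegral_level_indicator {ν η : Measure ℝ} [SFinite ν] [SFinite η] {p q : ℝ} (hp : 1 ≤ p)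
    (hν0 : ∀ᵐ h ∂ν, 0 ≤ h)
    (hν : ∀ d ≥ 0, ∫⁻ h, ENNReal.ofReal (d - h) ∂ν = ENNReal.ofReal (d ^ p))
    (hη : ∀ n > 0, η (Ioi n) = ENNReal.ofReal (1 / n ^ q)) {a b n : ℝ} (hb : 0 ≤ b)
    (hn : 0 ≤ n) (hab : n = 0 → a = b) :
    ∫⁻ g, ∫⁻ r, indicator {z : (ℝ × ℝ) × ℝ | a > z.1.2 + z.1.1 ∧ ¬ b > z.1.2 ∧ n < z.2} 1 (g, r) ∂η
      ∂(ν.prod (volume.restrict (Ioi 0))) = ENNReal.ofReal (max (a - b) 0 ^ p / n ^ q) := by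
  have h1 : ∀ g : ℝ × ℝ, ∫⁻ r, indicator {z : (ℝ × ℝ) × ℝ | a > z.1.2 + z.1.1 ∧ ¬ b > z.1.2 ∧
      n < z.2} 1 (g, r) ∂η =
      η (Ioi n) * indicator {g : ℝ × ℝ | a > g.2 + g.1 ∧ ¬ b > g.2} 1 g := by
    intro g
    by_cases hg : g ∈ {g : ℝ × ℝ | a > g.2 + g.1 ∧ ¬ b > g.2}
    · rw [indicator_of_mem hg, Pi.one_apply, mul_one, ← lintegral_indicator_one measurableSet_Ioi]
      refine lintegral_congr fun r => ?_
      by_cases hr : n < r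
      · rw [indicator_of_mem (show r ∈ Ioi n from hr), indicator_of_mem]
        · rfl
        · exact ⟨hg.1, hg.2, hr⟩
      · rw [indicator_of_notMem (show r ∉ Ioi n from hr), indicator_of_notMem]
        exact fun h => hr h.2.2
    · rw [indicator_of_notMem hg, mul_zero]
      refine (lintegral_congr fun r => indicator_of_notMem ?_ _).trans lintegral_zero
      exact fun h => hg ⟨h.1, h.2.1⟩
  have hm : MeasurableSet {g : ℝ × ℝ | a > g.2 + g.1 ∧ ¬ b > g.2} :=
    (measurableSet_lt (f := fun g : ℝ × ℝ => g.2 + g.1) (by fun_prop) measurable_const).inter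
      (measurableSet_lt (f := fun g : ℝ × ℝ => g.2) (by fun_prop) measurable_const).compl
  have h2 : ∫⁻ g, indicator {g : ℝ × ℝ | a > g.2 + g.1 ∧ ¬ b > g.2} 1 g
      ∂(ν.prod (volume.restrict (Ioi 0))) = ENNReal.ofReal (max (a - b) 0 ^ p) := by
    rw [lintegral_indicator_one hm, Measure.prod_apply hm, ← hν _ (le_max_right _ _)]
    refine lintegral_congr_ae ?_
    filter_upwards [hν0] with h hh
    have e : volume.restrict (Ioi 0) (Prod.mk h ⁻¹' {g : ℝ × ℝ | a > g.2 + g.1 ∧ ¬ b > g.2}) =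
        volume {σ : ℝ | 0 < σ ∧ a > σ + h ∧ ¬ b > σ} := by
      rw [Measure.restrict_apply (measurable_prodMk_left hm), inter_comm]
      rfl
    rw [e, volume_level_window hb]
    rcases le_total (a - b) 0 with h0 | h0
    · rw [max_eq_right h0, ENNReal.ofReal_of_nonpos (by linarith),
        ENNReal.ofReal_of_nonpos (by linarith)]
    · rw [max_eq_left h0]
  simp_rw [h1]
  rw [lintegral_const_mul _ (measurable_one.indicator hm), h2]
  -- On the diagonal `n = 0` the tail mass is not controlled, but `a = b` makes both sides vanish.
  rcases hn.eq_or_lt with h0 | h0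
  · rw [hab h0.symm, sub_self, max_self, Real.zero_rpow (by linarith)]
    simp
  · rw [hη n h0, ← ENNReal.ofReal_mul (by positivity)]
    congr 1
    ring

theorem ofReal_abs_rpow_div (a b p q n : ℝ) (hp : 0 < p) (hn : 0 ≤ n) :
    ENNReal.ofReal (|a - b| ^ p / n ^ q) = ENNReal.ofReal (max (a - b) 0 ^ p / n ^ q) +
      ENNReal.ofReal (max (b - a) 0 ^ p / n ^ q) := by
  have hq := Real.rpow_nonneg hn q
  rw [← ENNReal.ofReal_add (div_nonneg (Real.rpow_nonneg (le_max_right _ _) _) hq)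
    (div_nonneg (Real.rpow_nonneg (le_max_right _ _) _) hq)]
  congr 1
  rcases le_total a b with h | h
  · rw [abs_of_nonpos (by linarith), max_eq_right (by linarith : a - b ≤ 0),
      max_eq_left (by linarith : 0 ≤ b - a), Real.zero_rpow hp.ne', neg_sub]
    ring
  · rw [abs_of_nonneg (by linarith), max_eq_left (by linarith : 0 ≤ a - b),
      max_eq_right (by linarith : b - a ≤ 0), Real.zero_rpow hp.ne']
    ring

/-- Exchanging `(x, t)` and `(y, u)` leaves the kernel unchanged and swaps the two one-sided parts
of `|F x t - F y u| ^ p`. -/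
theorem sliceEnergy_eq_two_mul (μ : Measure X) [SFinite μ] {N : X → X → ℝ → ℝ}
    (hN : IsSliceKernel N) {F : X → ℝ → ℝ} (hF : Measurable (Function.uncurry F)) {p : ℝ}
    (hp : 0 < p) (q : ℝ) :
    sliceEnergy μ N q p F = 2 * ∫⁻ w, ∫⁻ v, ENNReal.ofReal
      (max (F w.1 v.1 - F w.2 v.2) 0 ^ p / N w.1 w.2 (v.1 - v.2) ^ q)
        ∂(volume.prod volume) ∂(μ.prod μ) := by
  set Q : (X × X) × (ℝ × ℝ) → ENNReal := fun z => ENNReal.ofReal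
    (max (F z.1.1 z.2.1 - F z.1.2 z.2.2) 0 ^ p / N z.1.1 z.1.2 (z.2.1 - z.2.2) ^ q) with hQ
  have m1 : Measurable fun z : (X × X) × (ℝ × ℝ) => F z.1.1 z.2.1 :=
    hF.comp (f := fun z : (X × X) × (ℝ × ℝ) => (z.1.1, z.2.1)) (by fun_prop)
  have m2 : Measurable fun z : (X × X) × (ℝ × ℝ) => F z.1.2 z.2.2 :=
    hF.comp (f := fun z : (X × X) × (ℝ × ℝ) => (z.1.2, z.2.2)) (by fun_prop)
  have m3 : Measurable fun z : (X × X) × (ℝ × ℝ) => N z.1.1 z.1.2 (z.2.1 - z.2.2) :=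
    hN.measurable.comp (f := fun z : (X × X) × (ℝ × ℝ) => (z.1, z.2.1 - z.2.2)) (by fun_prop)
  have hQm : Measurable Q := by
    refine ENNReal.measurable_ofReal.comp (Measurable.div ?_ ?_)
    · exact ((m1.sub m2).max measurable_const).pow_const p
    · exact m3.pow_const q
  set P : (X × X) × (ℝ × ℝ) → ENNReal := fun z => Q z + Q (z.1.swap, z.2.swap) with hP
  have hQsm : Measurable fun z : (X × X) × (ℝ × ℝ) => Q (z.1.swap, z.2.swap) :=
    hQm.comp (by fun_prop)
  have hPm : Measurable P := hQm.add hQsm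
  have e1 : sliceEnergy μ N q p F = ∫⁻ w, ∫⁻ v, P (w, v) ∂(volume.prod volume) ∂(μ.prod μ) := by
    rw [lintegral_prod _ (Measurable.lintegral_prod_right' hPm).aemeasurable]
    refine lintegral_congr fun x => lintegral_congr fun y => ?_
    rw [lintegral_prod (fun v => P ((x, y), v)) (hPm.comp measurable_prodMk_left).aemeasurable]
    refine lintegral_congr fun t => lintegral_congr fun u => ?_
    have hs : N y x (u - t) = N x y (t - u) := by rw [← hN.symm x y, neg_sub]
    simp only [hP, hQ, Prod.fst_swap, Prod.snd_swap, hs]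
    exact ofReal_abs_rpow_div _ _ _ _ _ hp (hN.nonneg _ _ _)
  have e2 : ∫⁻ w, ∫⁻ v, Q (w.swap, v.swap) ∂(volume.prod volume) ∂(μ.prod μ) =
      ∫⁻ w, ∫⁻ v, Q (w, v) ∂(volume.prod volume) ∂(μ.prod μ) := by
    have e3 : ∀ w : X × X, ∫⁻ v, Q (w.swap, v.swap) ∂(volume.prod volume) =
        ∫⁻ v, Q (w.swap, v) ∂(volume.prod volume) := fun w =>
      lintegral_prod_swap (μ := (volume : Measure ℝ)) (ν := (volume : Measure ℝ))
        (fun v => Q (w.swap, v))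
    simp_rw [e3]
    exact lintegral_prod_swap (μ := μ) (ν := μ)
      (fun w => ∫⁻ v, Q (w, v) ∂(volume.prod volume))
  rw [e1, two_mul]
  nth_rewrite 2 [← e2]
  rw [← lintegral_add_left (Measurable.lintegral_prod_right' hQm)]
  exact lintegral_congr fun w => lintegral_add_left (hQm.comp measurable_prodMk_left) _

/-- Layer cake representation of the energy in the function and in the kernel. -/
theorem sliceEnergy_eq_lintegral_levelPairs (μ : Measure X) [SFinite μ] {N : X → X → ℝ → ℝ}
    (hN : IsSliceKernel N) {F : X → ℝ → ℝ} (hF : Measurable (Function.uncurry F))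
    (hF0 : ∀ x t, 0 ≤ F x t)
    {ν η : Measure ℝ} [SFinite ν] [SFinite η] {p q : ℝ} (hp : 1 ≤ p) (hν0 : ∀ᵐ h ∂ν, 0 ≤ h)
    (hν : ∀ d ≥ 0, ∫⁻ h, ENNReal.ofReal (d - h) ∂ν = ENNReal.ofReal (d ^ p))
    (hη : ∀ n > 0, η (Ioi n) = ENNReal.ofReal (1 / n ^ q)) :
    sliceEnergy μ N q p F =
      2 * ∫⁻ z, volume (levelPairs N F z.1.1.1 z.1.1.2 z.1.2.1 z.1.2.2 z.2)
        ∂(((ν.prod (volume.restrict (Ioi 0))).prod (μ.prod μ)).prod η) := by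
  set S : Set ((((ℝ × ℝ) × (X × X)) × ℝ) × (ℝ × ℝ)) :=
    {z | z.2 ∈ levelPairs N F z.1.1.1.1 z.1.1.1.2 z.1.1.2.1 z.1.1.2.2 z.1.2} with hS
  have hSm : MeasurableSet S := measurableSet_levelPairs hN hF
  set I : (((ℝ × ℝ) × (X × X)) × ℝ) × (ℝ × ℝ) → ENNReal := S.indicator 1 with hI
  have hIm : Measurable I := measurable_one.indicator hSm
  rw [sliceEnergy_eq_two_mul μ hN hF (by linarith) q]
  congr 1
  set γ := ν.prod (volume.restrict (Ioi (0 : ℝ)))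
  have e1 : ∀ w : X × X, ∀ v : ℝ × ℝ, ENNReal.ofReal
      (max (F w.1 v.1 - F w.2 v.2) 0 ^ p / N w.1 w.2 (v.1 - v.2) ^ q) =
      ∫⁻ g, ∫⁻ r, I (((g, w), r), v) ∂η ∂γ := by
    intro w v
    rw [← lintegral_level_indicator hp hν0 hν hη (hF0 w.2 v.2) (hN.nonneg w.1 w.2 (v.1 - v.2))]
    · rfl
    · intro h0
      obtain ⟨h1, h2⟩ := hN.eq_of_eq_zero _ _ _ h0
      rw [h1, sub_eq_zero.1 h2]
  have e2 : ∀ z : ((ℝ × ℝ) × (X × X)) × ℝ,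
      volume (levelPairs N F z.1.1.1 z.1.1.2 z.1.2.1 z.1.2.2 z.2) = ∫⁻ v, I (z, v) := by
    intro z
    rw [← lintegral_indicator_one]
    · rfl
    · exact measurable_prodMk_left (x := z) hSm
  simp_rw [e1, e2]
  have mG : Measurable fun z : ((ℝ × ℝ) × (X × X)) × (ℝ × ℝ) =>
      ∫⁻ r, I ((z.1, r), z.2) ∂η := by
    have : Measurable fun y : (((ℝ × ℝ) × (X × X)) × (ℝ × ℝ)) × ℝ =>
        I ((y.1.1, y.2), y.1.2) := hIm.comp (by fun_prop)
    exact Measurable.lintegral_prod_right' this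
  have mV : Measurable fun z : ((ℝ × ℝ) × (X × X)) × ℝ => ∫⁻ v, I (z, v) :=
    Measurable.lintegral_prod_right' hIm
  -- Tonelli moves the integral over the pair of heights `v` to the innermost place and the one over
  -- the levels `g = (h, σ)` to the outermost.
  calc ∫⁻ w, ∫⁻ v, ∫⁻ g, ∫⁻ r, I (((g, w), r), v) ∂η ∂γ ∂(volume.prod volume) ∂(μ.prod μ)
      = ∫⁻ w, ∫⁻ g, ∫⁻ v, ∫⁻ r, I (((g, w), r), v) ∂η ∂(volume.prod volume) ∂γ ∂(μ.prod μ) := by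
        refine lintegral_congr fun w => lintegral_lintegral_swap ?_
        exact (mG.comp (f := fun y : (ℝ × ℝ) × (ℝ × ℝ) => ((y.2, w), y.1))
          (by fun_prop)).aemeasurable
    _ = ∫⁻ g, ∫⁻ w, ∫⁻ v, ∫⁻ r, I (((g, w), r), v) ∂η ∂(volume.prod volume) ∂(μ.prod μ) ∂γ := by
        refine lintegral_lintegral_swap ?_
        refine Measurable.aemeasurable ?_
        exact Measurable.lintegral_prod_right'
          (f := fun y : ((X × X) × (ℝ × ℝ)) × (ℝ × ℝ) => ∫⁻ r, I (((y.1.2, y.1.1), r), y.2) ∂η)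
          (mG.comp (f := fun y : ((X × X) × (ℝ × ℝ)) × (ℝ × ℝ) => ((y.1.2, y.1.1), y.2))
            (by fun_prop))
    _ = ∫⁻ g, ∫⁻ w, ∫⁻ r, ∫⁻ v, I (((g, w), r), v) ∂(volume.prod volume) ∂η ∂(μ.prod μ) ∂γ := by
        refine lintegral_congr fun g => lintegral_congr fun w => lintegral_lintegral_swap ?_
        exact (hIm.comp (f := fun y : (ℝ × ℝ) × ℝ => (((g, w), y.2), y.1))
          (by fun_prop)).aemeasurable
    _ = _ := by
        rw [lintegral_prod _ mV.aemeasurable, lintegral_prod _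
          (Measurable.lintegral_prod_right' mV).aemeasurable]
        rfl

end SliceEnergy

/-! ### The inequality for slice energies, and sufficiency of concentric levels -/

section SliceEquality

variable {X : Type*} [MeasurableSpace X]

/-- The set is, up to a null set, a bounded (possibly empty) interval centered at `c`. -/
def IsCenteredInterval (A : Set ℝ) (c : ℝ) : Prop :=
  ∃ r : ℝ, A =ᵐ[volume] Ioo (c - r) (c + r)

theorem isCenteredInterval_of_volume_eq_zero {A : Set ℝ} (h : volume A = 0) (c : ℝ) :
    IsCenteredInterval A c := by
  refine ⟨0, ?_⟩
  rw [sub_zero, add_zero, Ioo_self]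
  exact ae_eq_empty.2 h

theorem IsCenteredInterval.ae_eq {A : Set ℝ} {c a : ℝ} (h : IsCenteredInterval A c) (ha : 0 ≤ a)
    (hA : volume A = ENNReal.ofReal a) : A =ᵐ[volume] Ioo (c - a / 2) (c + a / 2) := by
  obtain ⟨r, hr⟩ := h
  have h1 : ENNReal.ofReal (2 * r) = ENNReal.ofReal a := by
    rw [← hA, measure_congr hr, Real.volume_Ioo]
    congr 1
    ring
  rcases ha.eq_or_lt with rfl | h0
  · rw [zero_div, sub_zero, add_zero, Ioo_self]
    rw [ENNReal.ofReal_zero] at hA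
    exact ae_eq_empty.2 hA
  · have h2 : 0 < 2 * r := by
      rw [← ENNReal.ofReal_pos, h1]
      exact ENNReal.ofReal_pos.2 h0
    have h3 := (ENNReal.ofReal_eq_ofReal_iff h2.le ha).1 h1
    have h4 : r = a / 2 := by linarith
    rwa [h4] at hr

theorem IsCenteredInterval.volume_ne_top {A : Set ℝ} {c : ℝ} (h : IsCenteredInterval A c) :
    volume A ≠ ⊤ := by
  obtain ⟨r, hr⟩ := h
  rw [measure_congr hr, Real.volume_Ioo]
  exact ENNReal.ofReal_ne_top

/-- If `c < c'`, a piece of positive length at the left end of the interval around `c` misses the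
interval of the same length around `c'`. -/
theorem IsCenteredInterval.le_center {A : Set ℝ} {c c' : ℝ} (h : IsCenteredInterval A c)
    (h' : IsCenteredInterval A c') (hA : volume A ≠ 0) : c' ≤ c := by
  have hA' := (ENNReal.ofReal_toReal h.volume_ne_top).symm
  set a := (volume A).toReal
  have ha0 : 0 < a := ENNReal.toReal_pos hA h.volume_ne_top
  have e := (h.ae_eq ha0.le hA').symm.trans (h'.ae_eq ha0.le hA')
  by_contra! hlt
  have h1 : volume (Ioo (c - a / 2) (min (c + a / 2) (c' - a / 2))) = 0 := by
    refine measure_mono_null (t := Ioo (c - a / 2) (c + a / 2) \ Ioo (c' - a / 2) (c' + a / 2))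
      (fun t ht => ?_) (ae_le_set.1 e.le)
    have h2 := lt_min_iff.1 ht.2
    exact ⟨⟨ht.1, h2.1⟩, fun h3 => lt_asymm h3.1 h2.2⟩
  rw [Real.volume_Ioo, ENNReal.ofReal_eq_zero, sub_nonpos, min_le_iff] at h1
  rcases h1 with h1 | h1 <;> linarith

theorem IsCenteredInterval.center_unique {A : Set ℝ} {c c' : ℝ} (h : IsCenteredInterval A c)
    (h' : IsCenteredInterval A c') (hA : volume A ≠ 0) : c = c' :=
  le_antisymm (h'.le_center h hA) (h.le_center h' hA)

theorem measurableSet_superlevel {F : X → ℝ → ℝ} (hF : Measurable (Function.uncurry F)) (x : X)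
    (τ : ℝ) : MeasurableSet {t | F x t > τ} :=
  measurableSet_lt measurable_const hF.of_uncurry_left

theorem volume_levelPairs_sliceSymm {X : Type*} {N : X → X → ℝ → ℝ} {F G : X → ℝ → ℝ}
    (hG : IsSliceSymm F G)
    {h σ : ℝ} (hh : 0 ≤ h) (hσ : 0 < σ) {x y : X} {r ρ : ℝ}
    (hρ : {t | N x y t < r} = Ioo (-ρ) ρ) {a b : ℝ}
    (ha : volume {t | F x t > σ + h} = ENNReal.ofReal a)
    (hb : volume {t | F y t > σ} = ENNReal.ofReal b) :
    volume (levelPairs N G h σ x y r) =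
      overlap (Ioo (-(a / 2)) (a / 2)) (Ioo (-(b / 2)) (b / 2))ᶜ ρ := by
  rw [volume_levelPairs G h σ hρ, ← schwarzSymm_eq_Ioo ha, ← schwarzSymm_eq_Ioo hb]
  exact overlap_congr (hG x _ (by linarith)) (hG y _ hσ).compl ρ

theorem volume_levelPairs_sliceSymm_le {N : X → X → ℝ → ℝ} (hN : IsSliceKernel N)
    {F G : X → ℝ → ℝ} (hF : Measurable (Function.uncurry F))
    (hfin : ∀ x, ∀ τ > 0, volume {t | F x t > τ} ≠ ⊤) (hG : IsSliceSymm F G)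
    {h σ : ℝ} (hh : 0 ≤ h) (hσ : 0 < σ) (x y : X) (r : ℝ) :
    volume (levelPairs N G h σ x y r) ≤ volume (levelPairs N F h σ x y r) := by
  obtain ⟨ρ, hρ⟩ := hN.sublevel x y r
  have ha := (ENNReal.ofReal_toReal (hfin x (σ + h) (by linarith))).symm
  have hb := (ENNReal.ofReal_toReal (hfin y σ hσ)).symm
  rw [volume_levelPairs_sliceSymm hG hh hσ hρ ha hb, volume_levelPairs F h σ hρ]
  exact overlap_compl_Ioo_le (measurableSet_superlevel hF x _) (measurableSet_superlevel hF y _)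
    ENNReal.toReal_nonneg ha hb ρ

theorem ae_nonneg_and_pos_prod {ν : Measure ℝ} [SFinite ν] (hν0 : ∀ᵐ h ∂ν, 0 ≤ h) :
    ∀ᵐ g ∂(ν.prod (volume.restrict (Ioi (0 : ℝ)))), 0 ≤ g.1 ∧ 0 < g.2 := by
  have h2 : ∀ᵐ σ : ℝ ∂(volume.restrict (Ioi 0)), 0 < σ := ae_restrict_mem measurableSet_Ioi
  filter_upwards [Measure.quasiMeasurePreserving_fst.ae hν0,
    Measure.quasiMeasurePreserving_snd.ae h2] with g h3 h4 using ⟨h3, h4⟩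

theorem ae_level_parameters_nonneg {Y : Type*} [MeasurableSpace Y] {ν : Measure ℝ} [SFinite ν]
    (hν0 : ∀ᵐ h ∂ν, 0 ≤ h) {η : Measure ℝ} [SFinite η] {θ : Measure Y} [SFinite θ] :
    ∀ᵐ z ∂(((ν.prod (volume.restrict (Ioi (0 : ℝ)))).prod θ).prod η),
      0 ≤ z.1.1.1 ∧ 0 < z.1.1.2 := by
  have h1 : ∀ᵐ w ∂((ν.prod (volume.restrict (Ioi (0 : ℝ)))).prod θ), 0 ≤ w.1.1 ∧ 0 < w.1.2 :=
    Measure.quasiMeasurePreserving_fst.ae (ae_nonneg_and_pos_prod hν0)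
  exact Measure.quasiMeasurePreserving_fst.ae h1

/-- By the layer cake representation it suffices to compare integrands, and there the inequality is
the complemented Riesz inequality for two level sets. -/
theorem sliceEnergy_sliceSymm_le (μ : Measure X) [SFinite μ] {N : X → X → ℝ → ℝ}
    (hN : IsSliceKernel N) {F G : X → ℝ → ℝ} (hF : Measurable (Function.uncurry F))
    (hF0 : ∀ x t, 0 ≤ F x t) (hfin : ∀ x, ∀ τ > 0, volume {t | F x t > τ} ≠ ⊤)
    (hGm : Measurable (Function.uncurry G)) (hG0 : ∀ x t, 0 ≤ G x t) (hG : IsSliceSymm F G)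
    {p q : ℝ} (hp : 1 ≤ p) (hq : 0 < q) :
    sliceEnergy μ N q p G ≤ sliceEnergy μ N q p F := by
  obtain ⟨ν, _, hν0, hν, -, -⟩ := exists_measure_lintegral_sub_eq_rpow hp
  obtain ⟨η, _, hη, -⟩ := exists_measure_Ioi_eq_rpow hq
  rw [sliceEnergy_eq_lintegral_levelPairs μ hN hF hF0 hp hν0 hν hη,
    sliceEnergy_eq_lintegral_levelPairs μ hN hGm hG0 hp hν0 hν hη]
  gcongr 2 * ?_
  refine lintegral_mono_ae ?_
  filter_upwards [ae_level_parameters_nonneg hν0] with z hz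
  exact volume_levelPairs_sliceSymm_le hN hF hfin hG hz.1 hz.2 _ _ _

theorem measurable_volume_levelPairs {N : X → X → ℝ → ℝ} (hN : IsSliceKernel N)
    {F : X → ℝ → ℝ} (hF : Measurable (Function.uncurry F)) :
    Measurable fun z : ((ℝ × ℝ) × (X × X)) × ℝ =>
      volume (levelPairs N F z.1.1.1 z.1.1.2 z.1.2.1 z.1.2.2 z.2) :=
  measurable_measure_prodMk_left (measurableSet_levelPairs hN hF)

/-- If almost all pairs of levels of `F` are concentric, then `F` and its symmetrization have the
same energy. -/
theorem sliceEnergy_sliceSymm_eq (μ : Measure X) [SFinite μ] {N : X → X → ℝ → ℝ}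
    (hN : IsSliceKernel N) {F G : X → ℝ → ℝ} (hF : Measurable (Function.uncurry F))
    (hF0 : ∀ x t, 0 ≤ F x t) (hfin : ∀ x, ∀ τ > 0, volume {t | F x t > τ} ≠ ⊤)
    (hGm : Measurable (Function.uncurry G)) (hG0 : ∀ x t, 0 ≤ G x t) (hG : IsSliceSymm F G)
    {ν : Measure ℝ} [SFinite ν] {p q : ℝ} (hp : 1 ≤ p) (hν0 : ∀ᵐ h ∂ν, 0 ≤ h)
    (hν : ∀ d ≥ 0, ∫⁻ h, ENNReal.ofReal (d - h) ∂ν = ENNReal.ofReal (d ^ p)) (hq : 0 < q)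
    (H : ∀ᵐ g ∂(ν.prod (volume.restrict (Ioi 0))), ∃ c, ∀ᵐ x ∂μ,
      IsCenteredInterval {t | F x t > g.2 + g.1} c ∧ IsCenteredInterval {t | F x t > g.2} c) :
    sliceEnergy μ N q p F = sliceEnergy μ N q p G := by
  obtain ⟨η, _, hη, -⟩ := exists_measure_Ioi_eq_rpow hq
  rw [sliceEnergy_eq_lintegral_levelPairs μ hN hF hF0 hp hν0 hν hη,
    sliceEnergy_eq_lintegral_levelPairs μ hN hGm hG0 hp hν0 hν hη]
  congr 1
  have mF := measurable_volume_levelPairs hN hF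
  have mG := measurable_volume_levelPairs hN hGm
  rw [lintegral_prod _ mF.aemeasurable, lintegral_prod _ mG.aemeasurable,
    lintegral_prod _ mF.lintegral_prod_right'.aemeasurable,
    lintegral_prod _ mG.lintegral_prod_right'.aemeasurable]
  refine lintegral_congr_ae ?_
  have hpos : ∀ᵐ g ∂(ν.prod (volume.restrict (Ioi (0 : ℝ)))), 0 ≤ g.1 ∧ 0 < g.2 :=
    ae_nonneg_and_pos_prod hν0
  filter_upwards [H, hpos] with g hg hg0
  obtain ⟨c, hc⟩ := hg
  refine lintegral_congr_ae ?_
  filter_upwards [Measure.quasiMeasurePreserving_fst.ae hc,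
    Measure.quasiMeasurePreserving_snd.ae hc] with w h1 h2
  refine lintegral_congr fun r => ?_
  obtain ⟨ρ, hρ⟩ := hN.sublevel w.1 w.2 r
  have ha := (ENNReal.ofReal_toReal (hfin w.1 (g.2 + g.1) (by linarith))).symm
  have hb := (ENNReal.ofReal_toReal (hfin w.2 g.2 hg0.2)).symm
  rw [volume_levelPairs_sliceSymm hG hg0.1 hg0.2 hρ ha hb, volume_levelPairs F _ _ hρ,
    overlap_congr (h1.1.ae_eq ENNReal.toReal_nonneg ha)
      (h2.2.ae_eq ENNReal.toReal_nonneg hb).compl, overlap_compl_translate]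

end SliceEquality

/-! ### Rigidity: from equal energies to common centers -/

section SliceRigidity

variable {X : Type*} [MeasurableSpace X]

/-- Ordered integrands with equal finite integrals agree almost everywhere, so Riesz equality holds
for almost every `r`. Strict monotonicity of the kernel makes these `r` reach the critical radii. -/
theorem concentric_levels_of_sliceEnergy_eq (μ : Measure X) [SFinite μ] {N : X → X → ℝ → ℝ}
    (hN : IsSliceKernel N) (hmono : ∀ x y, StrictMonoOn (N x y) (Ici 0))
    {F G : X → ℝ → ℝ} (hF : Measurable (Function.uncurry F))
    (hF0 : ∀ x t, 0 ≤ F x t) (hfin : ∀ x, ∀ τ > 0, volume {t | F x t > τ} ≠ ⊤)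
    (hGm : Measurable (Function.uncurry G)) (hG0 : ∀ x t, 0 ≤ G x t) (hG : IsSliceSymm F G)
    {ν : Measure ℝ} [SFinite ν] {p q : ℝ} (hp : 1 ≤ p) (hν0 : ∀ᵐ h ∂ν, 0 ≤ h)
    (hν : ∀ d ≥ 0, ∫⁻ h, ENNReal.ofReal (d - h) ∂ν = ENNReal.ofReal (d ^ p)) (hq : 0 < q)
    (hE : sliceEnergy μ N q p F = sliceEnergy μ N q p G) (hE' : sliceEnergy μ N q p F ≠ ⊤) :
    ∀ᵐ g ∂(ν.prod (volume.restrict (Ioi (0 : ℝ)))), ∀ᵐ w ∂(μ.prod μ),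
      volume {t | F w.1 t > g.2 + g.1} ≠ 0 → volume {t | F w.2 t > g.2} ≠ 0 →
      ∃ c, IsCenteredInterval {t | F w.1 t > g.2 + g.1} c ∧
        IsCenteredInterval {t | F w.2 t > g.2} c := by
  obtain ⟨η, _, hη, hηac⟩ := exists_measure_Ioi_eq_rpow hq
  have eF := sliceEnergy_eq_lintegral_levelPairs μ hN hF hF0 hp hν0 hν hη
  have eG := sliceEnergy_eq_lintegral_levelPairs μ hN hGm hG0 hp hν0 hν hη
  rw [eF, eG, ENNReal.mul_right_inj two_ne_zero ENNReal.ofNat_ne_top] at hE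
  rw [eF] at hE'
  have hfinF := (ENNReal.lt_top_of_mul_ne_top_right hE' two_ne_zero).ne
  have hle : (fun z : ((ℝ × ℝ) × (X × X)) × ℝ =>
      volume (levelPairs N G z.1.1.1 z.1.1.2 z.1.2.1 z.1.2.2 z.2))
      ≤ᵐ[((ν.prod (volume.restrict (Ioi 0))).prod (μ.prod μ)).prod η] fun z =>
      volume (levelPairs N F z.1.1.1 z.1.1.2 z.1.2.1 z.1.2.2 z.2) := by
    filter_upwards [ae_level_parameters_nonneg hν0] with z hz
    exact volume_levelPairs_sliceSymm_le hN hF hfin hG hz.1 hz.2 _ _ _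
  have heq := ae_eq_of_ae_le_of_lintegral_le hle (hE ▸ hfinF)
    (measurable_volume_levelPairs hN hF).aemeasurable hE.le
  filter_upwards [Measure.ae_ae_of_ae_prod (Measure.ae_ae_of_ae_prod heq),
    ae_nonneg_and_pos_prod hν0] with g hg hg0
  filter_upwards [hg] with w hw hA hB
  have hw1 : ∀ᵐ r : ℝ, r ∈ Ioi (0 : ℝ) →
      volume (levelPairs N G g.1 g.2 w.1 w.2 r) = volume (levelPairs N F g.1 g.2 w.1 w.2 r) :=
    (ae_restrict_iff' measurableSet_Ioi).1 (hηac.ae_le hw)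
  have fA := hfin w.1 (g.2 + g.1) (by linarith)
  have fB := hfin w.2 g.2 hg0.2
  have hAa := (ENNReal.ofReal_toReal fA).symm
  have hBb := (ENNReal.ofReal_toReal fB).symm
  have ha := ENNReal.toReal_pos hA fA
  have hb := ENNReal.toReal_pos hB fB
  obtain ⟨c, hc1, hc2⟩ := concentric_of_overlap_compl_eq (measurableSet_superlevel hF w.1 (g.2 + g.1))
    (measurableSet_superlevel hF w.2 g.2) ha hb hAa hBb (by
      intro ε hε
      set R := ((volume {t | F w.1 t > g.2 + g.1}).toReal + (volume {t | F w.2 t > g.2}).toReal) / 2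
        with hR
      have hR0 : 0 < R := by positivity
      have hlt : N w.1 w.2 R < N w.1 w.2 (R + ε) :=
        hmono _ _ hR0.le (by simp only [mem_Ici]; linarith) (by linarith)
      -- A good `r` between the kernel values at `R` and `R + ε` has a sublevel interval `(-ρ, ρ)`
      -- containing `R` but not `R + ε`, hence `R ≤ ρ ≤ R + ε`.
      obtain ⟨r, hr, hr1, hr2⟩ := (Measure.dense_of_ae hw1).exists_between hlt
      obtain ⟨ρ, hρ⟩ := hN.sublevel w.1 w.2 r
      have h1 : R ∈ Ioo (-ρ) ρ := hρ ▸ hr1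
      have h2 : R + ε ∉ Ioo (-ρ) ρ := by
        rw [← hρ]
        exact fun h => lt_asymm h hr2
      refine ⟨ρ, h1.2.le, ?_, ?_⟩
      · by_contra! h3
        exact h2 ⟨by linarith [h1.1], h3⟩
      · rw [← volume_levelPairs F _ _ hρ, ← volume_levelPairs_sliceSymm hG hg0.1 hg0.2 hρ hAa hBb]
        exact (hr ((hN.nonneg _ _ _).trans_lt hr1)).symm)
  exact ⟨c, ⟨_, hc1⟩, ⟨_, hc2⟩⟩

/-- If almost all pairs of slices are concentric at the levels `σ ≤ τ`, then both levels have a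
common center. -/
theorem exists_common_center {μ : Measure X} [SFinite μ] {F : X → ℝ → ℝ} {σ τ : ℝ} (hστ : σ ≤ τ)
    (hne : ∃ᶠ x in ae μ, volume {t | F x t > τ} ≠ 0)
    (H : ∀ᵐ w ∂(μ.prod μ), volume {t | F w.1 t > τ} ≠ 0 → volume {t | F w.2 t > σ} ≠ 0 →
      ∃ c, IsCenteredInterval {t | F w.1 t > τ} c ∧ IsCenteredInterval {t | F w.2 t > σ} c) :
    ∃ c, (∀ᵐ x ∂μ, IsCenteredInterval {t | F x t > σ} c) ∧
      ∀ᵐ x ∂μ, IsCenteredInterval {t | F x t > τ} c := by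
  have hne' : ∃ᶠ x in ae μ, volume {t | F x t > σ} ≠ 0 := by
    refine hne.mono fun x hx h0 => hx (measure_mono_null (fun t ht => ?_) h0)
    exact lt_of_le_of_lt hστ ht
  have H1 := Measure.ae_ae_of_ae_prod H
  have H2 : ∀ᵐ y ∂μ, ∀ᵐ x ∂μ, volume {t | F x t > τ} ≠ 0 → volume {t | F y t > σ} ≠ 0 →
      ∃ c, IsCenteredInterval {t | F x t > τ} c ∧ IsCenteredInterval {t | F y t > σ} c :=
    Measure.ae_ae_of_ae_prod (p := fun z : X × X => volume {t | F z.2 t > τ} ≠ 0 →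
      volume {t | F z.1 t > σ} ≠ 0 → ∃ c, IsCenteredInterval {t | F z.2 t > τ} c ∧
      IsCenteredInterval {t | F z.1 t > σ} c)
      (Measure.measurePreserving_swap.quasiMeasurePreserving.ae H)
  -- One generic `x` with a non-null `τ`-slice fixes the center of almost all `σ`-slices. A generic
  -- non-null `σ`-slice then carries it back to the `τ`-slices. Null slices are centered anywhere.
  obtain ⟨x, hx, hxH⟩ := (hne.and_eventually H1).exists
  obtain ⟨y, hy, hyH⟩ := (hne'.and_eventually hxH).exists
  obtain ⟨c, hc, -⟩ := hyH hx hy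
  have h1 : ∀ᵐ y ∂μ, IsCenteredInterval {t | F y t > σ} c := by
    filter_upwards [hxH] with y hy
    by_cases h0 : volume {t | F y t > σ} = 0
    · exact isCenteredInterval_of_volume_eq_zero h0 c
    · obtain ⟨c', h2, h3⟩ := hy hx h0
      rwa [hc.center_unique h2 hx]
  obtain ⟨y, ⟨hy, hyH⟩, hyc⟩ := ((hne'.and_eventually H2).and_eventually h1).exists
  refine ⟨c, h1, ?_⟩
  filter_upwards [hyH] with x hx
  by_cases h0 : volume {t | F x t > τ} = 0
  · exact isCenteredInterval_of_volume_eq_zero h0 c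
  · obtain ⟨c', h2, h3⟩ := hx h0 hy
    rwa [hyc.center_unique h3 hy]

theorem center_unique_of_ae {μ : Measure X} {F : X → ℝ → ℝ} {σ c c' : ℝ}
    (hne : ∃ᶠ x in ae μ, volume {t | F x t > σ} ≠ 0)
    (h : ∀ᵐ x ∂μ, IsCenteredInterval {t | F x t > σ} c)
    (h' : ∀ᵐ x ∂μ, IsCenteredInterval {t | F x t > σ} c') : c = c' := by
  obtain ⟨x, ⟨h1, h2⟩, h3⟩ := ((hne.and_eventually h).and_eventually h').exists
  exact h2.center_unique h3 h1

/-- Fubini turns non-triviality of a level into positive measure of a superlevel set on the product,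
where right continuity of the distribution function applies. -/
theorem frequently_volume_ne_zero_iff {μ : Measure X} [SFinite μ] {F : X → ℝ → ℝ}
    (hF : Measurable (Function.uncurry F)) (τ : ℝ) :
    (∃ᶠ x in ae μ, volume {t | F x t > τ} ≠ 0) ↔
      0 < (μ.prod volume) {z | Function.uncurry F z > τ} := by
  have hm : MeasurableSet {z | Function.uncurry F z > τ} := measurableSet_lt measurable_const hF
  rw [pos_iff_ne_zero, Ne, Measure.measure_prod_null hm, Filter.Frequently]
  refine not_congr (Filter.eventually_congr (Filter.Eventually.of_forall fun x => ?_))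
  rw [Ne, not_not]
  rfl

/-- The rigidity of the levels when almost all pairs of distinct levels are concentric. -/
theorem exists_center_all_levels {μ : Measure X} [SFinite μ] {F : X → ℝ → ℝ}
    (hF : Measurable (Function.uncurry F))
    (H : ∀ᵐ g ∂((volume.restrict (Ioi (0 : ℝ))).prod (volume.restrict (Ioi (0 : ℝ)))),
      ∀ᵐ w ∂(μ.prod μ),
      volume {t | F w.1 t > g.2 + g.1} ≠ 0 → volume {t | F w.2 t > g.2} ≠ 0 →
      ∃ c, IsCenteredInterval {t | F w.1 t > g.2 + g.1} c ∧
        IsCenteredInterval {t | F w.2 t > g.2} c) :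
    ∃ c, ∀ᵐ σ : ℝ, 0 < σ → ∀ᵐ x ∂μ, IsCenteredInterval {t | F x t > σ} c := by
  set good : ℝ → ℝ → Prop := fun σ τ => ∀ᵐ w ∂(μ.prod μ),
      volume {t | F w.1 t > τ} ≠ 0 → volume {t | F w.2 t > σ} ≠ 0 →
      ∃ c, IsCenteredInterval {t | F w.1 t > τ} c ∧ IsCenteredInterval {t | F w.2 t > σ} c
  set T : ℝ → Prop := fun τ => ∃ᶠ x in ae μ, volume {t | F x t > τ} ≠ 0
  have hgood : ∀ᵐ σ : ℝ, 0 < σ → ∀ᵐ τ : ℝ, σ < τ → good σ τ := by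
    have h1 : ∀ᵐ σ ∂(volume.restrict (Ioi (0 : ℝ))), ∀ᵐ h ∂(volume.restrict (Ioi (0 : ℝ))),
        good σ (σ + h) :=
      Measure.ae_ae_of_ae_prod (p := fun z : ℝ × ℝ => good z.1 (z.1 + z.2))
        (Measure.measurePreserving_swap.quasiMeasurePreserving.ae H)
    rw [ae_restrict_iff' measurableSet_Ioi] at h1
    filter_upwards [h1] with σ hσ hσ0
    have h2 := (ae_restrict_iff' measurableSet_Ioi).1 (hσ hσ0)
    have h3 := (measurePreserving_sub_right volume σ).quasiMeasurePreserving.ae h2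
    filter_upwards [h3] with τ hτ hστ
    have h4 := hτ (sub_pos.2 hστ)
    rwa [add_sub_cancel] at h4
  have hTanti : ∀ {σ τ : ℝ}, σ ≤ τ → T τ → T σ := fun hστ hT =>
    hT.mono fun x hx h0 => hx (measure_mono_null (fun t ht => lt_of_le_of_lt hστ ht) h0)
  have hTopen : ∀ {σ : ℝ}, T σ → ∃ τ > σ, T τ := by
    intro σ hσ
    obtain ⟨τ, h1, h2⟩ := exists_gt_of_lt_measure_superlevel _
      ((frequently_volume_ne_zero_iff hF σ).1 hσ)
    exact ⟨τ, h1, (frequently_volume_ne_zero_iff hF τ).2 h2⟩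
  have hcommon : ∀ {σ τ : ℝ}, σ < τ → T τ → good σ τ →
      ∃ c, (∀ᵐ x ∂μ, IsCenteredInterval {t | F x t > σ} c) ∧
        ∀ᵐ x ∂μ, IsCenteredInterval {t | F x t > τ} c :=
    fun hστ hT hg => exists_common_center hστ.le hT hg
  have hnull : ∀ {σ : ℝ}, ¬ T σ → ∀ c, ∀ᵐ x ∂μ, IsCenteredInterval {t | F x t > σ} c := by
    intro σ hσ c
    rw [Filter.not_frequently] at hσ
    filter_upwards [hσ] with x hx
    exact isCenteredInterval_of_volume_eq_zero (not_not.1 hx) c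
  by_cases hT : ∃ τ > 0, T τ
  · obtain ⟨τ0, hτ0, hTτ0⟩ := hT
    -- A generic non-trivial level `σ1` serves as reference and supplies the center `c`.
    obtain ⟨σ1, h1, hσ1, hσ1τ⟩ := (Measure.dense_of_ae hgood).exists_between hτ0
    have hTσ1 := hTanti hσ1τ.le hTτ0
    obtain ⟨τ1, g1, hτ1, hτ1'⟩ := (Measure.dense_of_ae (h1 hσ1)).exists_between hσ1τ
    obtain ⟨c, hc, -⟩ := hcommon hτ1 (hTanti hτ1'.le hTτ0) (g1 hτ1)
    refine ⟨c, ?_⟩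
    filter_upwards [hgood] with σ2 h2 hσ2
    by_cases hTσ2 : T σ2
    · have hTm : T (max σ1 σ2) := by
        rcases max_choice σ1 σ2 with h | h <;> rw [h] <;> assumption
      -- The levels `σ1` and `σ2` need not form a good pair. They are linked through a non-trivial
      -- level `τ` above both that is good with each; it exists because the set of non-trivial
      -- levels is open to the right.
      obtain ⟨τ', hτ', hTτ'⟩ := hTopen hTm
      obtain ⟨τ, ⟨k1, k2⟩, l1, l2⟩ :=
        (Measure.dense_of_ae ((h1 hσ1).and (h2 hσ2))).exists_between hτ'
      have hTτ := hTanti l2.le hTτ'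
      have m1 := (le_max_left σ1 σ2).trans_lt l1
      have m2 := (le_max_right σ1 σ2).trans_lt l1
      obtain ⟨c1, a1, b1⟩ := hcommon m1 hTτ (k1 m1)
      obtain ⟨c2, a2, b2⟩ := hcommon m2 hTτ (k2 m2)
      rw [center_unique_of_ae hTσ1 hc a1, center_unique_of_ae hTτ b1 b2]
      exact a2
    · exact hnull hTσ2 c
  · push Not at hT
    exact ⟨0, Filter.Eventually.of_forall fun σ hσ => hnull (hT σ hσ) 0⟩

/-- If all levels of `F` have the same center, then `F` is a translate of its symmetrization. -/
theorem ae_eq_translate_of_center {μ : Measure X} {F G : X → ℝ → ℝ}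
    (hF0 : ∀ x t, 0 ≤ F x t) (hfin : ∀ x, ∀ τ > 0, volume {t | F x t > τ} ≠ ⊤)
    (hG0 : ∀ x t, 0 ≤ G x t) (hG : IsSliceSymm F G) {c : ℝ}
    (H : ∀ᵐ σ : ℝ, 0 < σ → ∀ᵐ x ∂μ, IsCenteredInterval {t | F x t > σ} c) :
    ∀ᵐ x ∂μ, ∀ᵐ t : ℝ, F x t = G x (t - c) := by
  -- Countably many dense levels allow one null set of base points for all of them, and they still
  -- separate any two distinct values of the functions.
  obtain ⟨D, hD, hDc, hDd⟩ := (Measure.dense_of_ae H).exists_countable_dense_subset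
  have h1 : ∀ᵐ x ∂μ, ∀ σ ∈ D, 0 < σ → IsCenteredInterval {t | F x t > σ} c := by
    rw [ae_ball_iff hDc]
    intro σ hσ
    by_cases h0 : 0 < σ
    · filter_upwards [hD hσ h0] with x hx _ using hx
    · exact Filter.Eventually.of_forall fun x h => absurd h h0
  filter_upwards [h1] with x hx
  have h2 : ∀ᵐ t : ℝ, ∀ σ ∈ D, 0 < σ → (F x t > σ ↔ G x (t - c) > σ) := by
    rw [ae_ball_iff hDc]
    intro σ hσ
    by_cases h0 : 0 < σ
    · have ha := (ENNReal.ofReal_toReal (hfin x σ h0)).symm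
      have e1 := (hx σ hσ h0).ae_eq ENNReal.toReal_nonneg ha
      have e2 := hG x σ h0
      rw [schwarzSymm_eq_Ioo ha] at e2
      have e3 := (measurePreserving_sub_right volume c).quasiMeasurePreserving.ae e2
      filter_upwards [e1, e3] with t k1 k2 _
      refine k1.to_iff.trans (Iff.trans ?_ k2.to_iff.symm)
      change t ∈ Ioo _ _ ↔ t - c ∈ Ioo _ _
      simp only [mem_Ioo]
      constructor <;> rintro ⟨_, _⟩ <;> constructor <;> linarith
    · exact Filter.Eventually.of_forall fun x h => absurd h h0
  filter_upwards [h2] with t ht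
  rcases lt_trichotomy (F x t) (G x (t - c)) with h | h | h
  · obtain ⟨σ, hσ, k1, k2⟩ := hDd.exists_between h
    exact absurd ((ht σ hσ ((hF0 x t).trans_lt k1)).2 k2) (lt_asymm k1)
  · exact h
  · obtain ⟨σ, hσ, k1, k2⟩ := hDd.exists_between h
    exact absurd ((ht σ hσ ((hG0 x _).trans_lt k1)).1 k2) (lt_asymm k1)

theorem isCenteredInterval_of_translate {X : Type*} {F G : X → ℝ → ℝ}
    (hfin : ∀ x, ∀ τ > 0, volume {t | F x t > τ} ≠ ⊤) (hG : IsSliceSymm F G) {c : ℝ} {x : X}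
    (H : ∀ᵐ t : ℝ, F x t = G x (t - c)) {σ : ℝ} (hσ : 0 < σ) :
    IsCenteredInterval {t | F x t > σ} c := by
  have ha := (ENNReal.ofReal_toReal (hfin x σ hσ)).symm
  have e2 := hG x σ hσ
  rw [schwarzSymm_eq_Ioo ha] at e2
  refine ⟨(volume {t | F x t > σ}).toReal / 2, ?_⟩
  have e3 := (measurePreserving_sub_right volume c).quasiMeasurePreserving.ae e2
  filter_upwards [H, e3] with t k1 k2
  refine propext (Iff.trans ?_ (k2.to_iff.trans ?_))
  · change F x t > σ ↔ G x (t - c) > σ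
    rw [k1]
  · change t - c ∈ Ioo _ _ ↔ t ∈ Ioo _ _
    simp only [mem_Ioo]
    constructor <;> rintro ⟨_, _⟩ <;> constructor <;> linarith

end SliceRigidity

/-! ### Splitting off the last coordinate -/

section Splitting

variable {m : ℕ}

theorem joinLast_last (x : EuclideanSpace ℝ (Fin m)) (t : ℝ) :
    joinLast x t (Fin.last m) = t := by
  simp [joinLast]

theorem joinLast_castSucc (x : EuclideanSpace ℝ (Fin m)) (t : ℝ) (i : Fin m) :
    joinLast x t i.castSucc = x i := by
  simp [joinLast]

theorem initCoords_joinLast (x : EuclideanSpace ℝ (Fin m)) (t : ℝ) :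
    initCoords (joinLast x t) = x := by
  ext i
  simp [initCoords, joinLast_castSucc]

theorem joinLast_initCoords (z : EuclideanSpace ℝ (Fin (m + 1))) :
    joinLast (initCoords z) (z (Fin.last m)) = z := by
  ext i
  refine Fin.lastCases ?_ (fun j => ?_) i
  · rw [joinLast_last]
  · rw [joinLast_castSucc]; rfl

theorem joinLast_add_smul (x y : EuclideanSpace ℝ (Fin m)) (t u a b : ℝ) :
    joinLast (a • x + b • y) (a * t + b * u) = a • joinLast x t + b • joinLast y u := by
  ext i
  refine Fin.lastCases ?_ (fun j => ?_) i
  · simp [joinLast_last]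
  · simp [joinLast_castSucc]

theorem joinLast_sub (x y : EuclideanSpace ℝ (Fin m)) (t u : ℝ) :
    joinLast x t - joinLast y u = joinLast (x - y) (t - u) := by
  ext i
  refine Fin.lastCases ?_ (fun j => ?_) i
  · simp [joinLast_last]
  · simp [joinLast_castSucc]

theorem neg_joinLast (x : EuclideanSpace ℝ (Fin m)) (t : ℝ) :
    -joinLast x t = joinLast (-x) (-t) := by
  ext i
  refine Fin.lastCases ?_ (fun j => ?_) i
  · simp [joinLast_last]
  · simp [joinLast_castSucc]

theorem continuous_joinLast :
    Continuous fun z : EuclideanSpace ℝ (Fin m) × ℝ => joinLast z.1 z.2 := by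
  unfold joinLast
  refine (PiLp.continuous_toLp 2 _).comp (continuous_pi fun i => ?_)
  refine Fin.lastCases ?_ (fun j => ?_) i
  · simpa using continuous_snd
  · simp only [Fin.snoc_castSucc]
    fun_prop

theorem continuous_initCoords :
    Continuous (initCoords : EuclideanSpace ℝ (Fin (m + 1)) → EuclideanSpace ℝ (Fin m)) := by
  unfold initCoords
  fun_prop

/-- The splitting `ℝ^(m+1) ≃ ℝ^m × ℝ`. -/
noncomputable def splitLast (m : ℕ) :
    EuclideanSpace ℝ (Fin (m + 1)) ≃ᵐ EuclideanSpace ℝ (Fin m) × ℝ where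
  toFun z := (initCoords z, z (Fin.last m))
  invFun z := joinLast z.1 z.2
  left_inv z := joinLast_initCoords z
  right_inv z := Prod.ext (initCoords_joinLast z.1 z.2) (joinLast_last z.1 z.2)
  measurable_toFun := by
    refine Measurable.prodMk continuous_initCoords.measurable ?_
    fun_prop
  measurable_invFun := continuous_joinLast.measurable

theorem measurePreserving_splitLast (m : ℕ) : MeasurePreserving (splitLast m) := by
  have h1 := EuclideanSpace.volume_preserving_symm_measurableEquiv_toLp (Fin (m + 1))
  have h2 := volume_preserving_piFinSuccAbove (fun _ : Fin (m + 1) => ℝ) (Fin.last m)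
  have h3 : MeasurePreserving (Prod.swap : ℝ × (Fin m → ℝ) → (Fin m → ℝ) × ℝ) volume volume :=
    Measure.measurePreserving_swap
  have h4 : MeasurePreserving (MeasurableEquiv.toLp 2 (Fin m → ℝ)) volume volume :=
    (EuclideanSpace.volume_preserving_symm_measurableEquiv_toLp (Fin m)).symm
  have h5 := h4.prod (MeasurePreserving.id (volume : Measure ℝ))
  have h6 := h5.comp (h3.comp (h2.comp h1))
  have e : ⇑(splitLast m) = Prod.map (MeasurableEquiv.toLp 2 (Fin m → ℝ)) id ∘ Prod.swap ∘
      MeasurableEquiv.piFinSuccAbove (fun _ : Fin (m + 1) => ℝ) (Fin.last m) ∘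
      (MeasurableEquiv.toLp 2 (Fin (m + 1) → ℝ)).symm := by
    funext z
    refine Prod.ext ?_ rfl
    ext i
    change z i.castSucc = z ((Fin.last m).succAbove i)
    rw [Fin.succAbove_last]
  rw [e]
  exact h6

theorem measurePreserving_joinLast (m : ℕ) :
    MeasurePreserving fun z : EuclideanSpace ℝ (Fin m) × ℝ => joinLast z.1 z.2 :=
  (measurePreserving_splitLast m).symm

theorem lintegral_eq_lintegral_joinLast {φ : EuclideanSpace ℝ (Fin (m + 1)) → ENNReal}
    (hφ : Measurable φ) : ∫⁻ z, φ z = ∫⁻ x, ∫⁻ t, φ (joinLast x t) := by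
  rw [← (measurePreserving_joinLast m).lintegral_comp hφ, Measure.volume_eq_prod]
  exact lintegral_prod _ (hφ.comp continuous_joinLast.measurable).aemeasurable

theorem ae_joinLast {P : EuclideanSpace ℝ (Fin (m + 1)) → Prop} (h : ∀ᵐ z, P z) :
    ∀ᵐ x : EuclideanSpace ℝ (Fin m), ∀ᵐ t : ℝ, P (joinLast x t) :=
  Measure.ae_ae_of_ae_prod ((measurePreserving_joinLast m).quasiMeasurePreserving.ae h)

/-- This is the converse direction of Fubini for null sets, which requires the set to be measurable.
-/
theorem ae_of_ae_joinLast {P : EuclideanSpace ℝ (Fin (m + 1)) → Prop}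
    (hP : MeasurableSet {z | P z})
    (h : ∀ᵐ x : EuclideanSpace ℝ (Fin m), ∀ᵐ t : ℝ, P (joinLast x t)) : ∀ᵐ z, P z := by
  have h1 : ∀ᵐ z : EuclideanSpace ℝ (Fin m) × ℝ, P (joinLast z.1 z.2) :=
    (Measure.ae_prod_mem_iff_ae_ae_mem (continuous_joinLast.measurable hP)).2 h
  have h2 := (measurePreserving_splitLast m).quasiMeasurePreserving.ae h1
  filter_upwards [h2] with z hz
  rw [← joinLast_initCoords z]
  exact hz

theorem ae_initCoords {P : EuclideanSpace ℝ (Fin m) → Prop} (h : ∀ᵐ x, P x) :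
    ∀ᵐ z : EuclideanSpace ℝ (Fin (m + 1)), P (initCoords z) :=
  (measurePreserving_splitLast m).quasiMeasurePreserving.ae
    (p := fun w => P w.1) (Measure.quasiMeasurePreserving_fst.ae h)

theorem ae_last {P : ℝ → Prop} (h : ∀ᵐ t, P t) :
    ∀ᵐ z : EuclideanSpace ℝ (Fin (m + 1)), P (z (Fin.last m)) :=
  (measurePreserving_splitLast m).quasiMeasurePreserving.ae
    (p := fun w => P w.2) (Measure.quasiMeasurePreserving_snd.ae h)

theorem fracEnergy_congr_ae {d : ℕ} (N : EuclideanSpace ℝ (Fin d) → ℝ) (s p : ℝ)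
    {f g : EuclideanSpace ℝ (Fin d) → ℝ} (h : f =ᵐ[volume] g) :
    fracEnergy N s p f = fracEnergy N s p g := by
  refine lintegral_congr_ae ?_
  filter_upwards [h] with x hx
  refine lintegral_congr_ae ?_
  filter_upwards [h] with y hy
  rw [hx, hy]

theorem lintegral_lintegral_joinLast
    {κ : EuclideanSpace ℝ (Fin (m + 1)) × EuclideanSpace ℝ (Fin (m + 1)) → ENNReal}
    (hκ : Measurable κ) :
    ∫⁻ z, ∫⁻ w, κ (z, w) = ∫⁻ x, ∫⁻ y, ∫⁻ t, ∫⁻ u, κ (joinLast x t, joinLast y u) := by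
  have hj := (continuous_joinLast (m := m)).measurable
  have h1 : Measurable fun z => ∫⁻ w, κ (z, w) := hκ.lintegral_prod_right'
  rw [lintegral_eq_lintegral_joinLast h1]
  refine lintegral_congr fun x => ?_
  have h2 : ∀ z, ∫⁻ w, κ (z, w) = ∫⁻ y, ∫⁻ u, κ (z, joinLast y u) := fun z =>
    lintegral_eq_lintegral_joinLast (hκ.comp measurable_prodMk_left)
  simp_rw [h2]
  refine lintegral_lintegral_swap (Measurable.aemeasurable ?_)
  have h3 : Measurable fun w : (ℝ × EuclideanSpace ℝ (Fin m)) × ℝ =>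
      κ (joinLast x w.1.1, joinLast w.1.2 w.2) :=
    hκ.comp ((hj.comp (f := fun w : (ℝ × EuclideanSpace ℝ (Fin m)) × ℝ => (x, w.1.1))
      (by fun_prop)).prodMk
      (hj.comp (f := fun w : (ℝ × EuclideanSpace ℝ (Fin m)) × ℝ => (w.1.2, w.2)) (by fun_prop)))
  exact h3.lintegral_prod_right'

theorem fracEnergy_eq_sliceEnergy {N : EuclideanSpace ℝ (Fin (m + 1)) → ℝ} (hN : Measurable N)
    (s p : ℝ) {f : EuclideanSpace ℝ (Fin (m + 1)) → ℝ} (hf : Measurable f) :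
    fracEnergy N s p f = sliceEnergy volume (fun x y t => N (joinLast (x - y) t))
      (((m + 1 : ℕ) : ℝ) + s * p) p fun x t => f (joinLast x t) := by
  have m1 : Measurable fun z : EuclideanSpace ℝ (Fin (m + 1)) × EuclideanSpace ℝ (Fin (m + 1)) =>
      |f z.1 - f z.2| ^ p :=
    (((hf.comp measurable_fst).sub (hf.comp measurable_snd)).abs).pow_const p
  have m2 : Measurable fun z : EuclideanSpace ℝ (Fin (m + 1)) × EuclideanSpace ℝ (Fin (m + 1)) =>
      N (z.1 - z.2) ^ (((m + 1 : ℕ) : ℝ) + s * p) :=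
    (hN.comp (measurable_fst.sub measurable_snd)).pow_const _
  have m3 : Measurable fun z : EuclideanSpace ℝ (Fin (m + 1)) × EuclideanSpace ℝ (Fin (m + 1)) =>
      ENNReal.ofReal (|f z.1 - f z.2| ^ p / N (z.1 - z.2) ^ (((m + 1 : ℕ) : ℝ) + s * p)) :=
    (m1.div m2).ennreal_ofReal
  refine (lintegral_lintegral_joinLast m3).trans ?_
  simp only [joinLast_sub]
  rfl

/-! ### The gauge of a convex body as a slice kernel -/

theorem eq_Ioo_of_symmetric {S : Set ℝ} (ho : IsOpen S) (hc : S.OrdConnected)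
    (hs : ∀ t ∈ S, -t ∈ S) (hb : BddAbove S) : ∃ ρ, S = Ioo (-ρ) ρ := by
  rcases S.eq_empty_or_nonempty with rfl | hne
  · exact ⟨0, by simp⟩
  have hlt : ∀ t ∈ S, t < sSup S := by
    intro t ht
    obtain ⟨ε, hε, h⟩ := Metric.isOpen_iff.1 ho t ht
    have : t + ε / 2 ∈ S := h (by
      rw [Metric.mem_ball, Real.dist_eq, add_sub_cancel_left, abs_of_pos (by linarith)]; linarith)
    exact lt_of_lt_of_le (by linarith) (le_csSup hb this)
  refine ⟨sSup S, Subset.antisymm (fun t ht => ⟨?_, hlt t ht⟩) fun t ht => ?_⟩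
  · linarith [hlt _ (hs t ht)]
  · obtain ⟨u, hu, h1⟩ := exists_lt_of_lt_csSup hne (abs_lt.2 ht)
    have h2 := abs_lt.1 h1
    exact hc.out (hs u hu) hu ⟨h2.1.le, h2.2.le⟩

/-- The origin is the midpoint of an interior point `x` and its reflection `-x`. -/
theorem IsConvexBody.mem_nhds_zero {d : ℕ} {K : Set (EuclideanSpace ℝ (Fin d))}
    (hK : IsConvexBody K) (hneg : ∀ x ∈ K, -x ∈ K) : K ∈ nhds 0 := by
  obtain ⟨x, hx⟩ := hK.interior_nonempty
  have h1 := hK.convex.combo_interior_self_mem_interior hx (hneg x (interior_subset hx))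
    (a := 1 / 2) (b := 1 / 2) (by norm_num) (by norm_num) (by norm_num)
  rw [smul_neg, add_neg_cancel] at h1
  exact mem_interior_iff_mem_nhds.1 h1

/-- Boundedness of `K` bounds the norm by the gauge. This yields definiteness of the gauge, bounded
sublevel sets and finiteness of the anisotropic energy. -/
theorem IsConvexBody.exists_norm_le_mul_gauge {d : ℕ} {K : Set (EuclideanSpace ℝ (Fin d))}
    (hK : IsConvexBody K) (hneg : ∀ x ∈ K, -x ∈ K) :
    ∃ R > 0, ∀ x, ‖x‖ ≤ R * gauge K x := by
  obtain ⟨R, hR, h⟩ := hK.isCompact.isBounded.exists_pos_norm_le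
  refine ⟨R, hR, fun x => ?_⟩
  have := le_gauge_of_subset_closedBall (absorbent_nhds_zero (hK.mem_nhds_zero hneg)) hR.le
    (fun y hy => by simpa using h y hy) (x := x)
  rwa [div_le_iff₀ hR, mul_comm] at this

theorem IsSymmetricInLast.gauge_eq {K : Set (EuclideanSpace ℝ (Fin (m + 1)))}
    (hs : IsSymmetricInLast K) (x : EuclideanSpace ℝ (Fin m)) (t : ℝ) :
    gauge K (joinLast x (-t)) = gauge K (joinLast x t) := by
  have key : ∀ (r : ℝ) (x : EuclideanSpace ℝ (Fin m)) (t : ℝ), r⁻¹ • joinLast x t ∈ K →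
      r⁻¹ • joinLast x (-t) ∈ K := by
    intro r x t h
    have e : ∀ t, r⁻¹ • joinLast x t = joinLast (r⁻¹ • x) (r⁻¹ * t) := by
      intro t
      have := joinLast_add_smul x 0 t 0 r⁻¹ 0
      simpa using this.symm
    rw [e] at h ⊢
    rw [mul_neg]
    exact hs _ _ h
  rw [gauge_def', gauge_def']
  congr 1
  ext r
  refine and_congr_right fun _ => ?_
  refine ⟨fun h => ?_, key r x t⟩
  simpa using key r x (-t) h

/-- The sublevel set of the gauge on a vertical line is open by continuity, an interval by
convexity, symmetric by the reflection, and bounded by comparison with the norm. -/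
theorem isSliceKernel_gauge {K : Set (EuclideanSpace ℝ (Fin (m + 1)))} (hK : IsConvexBody K)
    (hneg : ∀ x ∈ K, -x ∈ K) (hs : IsSymmetricInLast K) :
    IsSliceKernel fun (x y : EuclideanSpace ℝ (Fin m)) t => gauge K (joinLast (x - y) t) := by
  have h0 := hK.mem_nhds_zero hneg
  have hc : Continuous (gauge K) := continuous_gauge hK.convex h0
  obtain ⟨R, hR, hRK⟩ := hK.exists_norm_le_mul_gauge hneg
  have habs : Absorbent ℝ K := absorbent_nhds_zero h0
  refine ⟨?_, fun _ _ _ => gauge_nonneg _, fun x y t => ?_, fun x y t h => ?_, fun x y r => ?_⟩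
  · exact (hc.comp (continuous_joinLast.comp
      (f := fun z : (EuclideanSpace ℝ (Fin m) × EuclideanSpace ℝ (Fin m)) × ℝ =>
        (z.1.1 - z.1.2, z.2)) (by fun_prop))).measurable
  · rw [← neg_sub x y, ← neg_joinLast, gauge_neg hneg]
  · have h1 := hRK (joinLast (x - y) t)
    rw [h, mul_zero] at h1
    have h2 := norm_le_zero_iff.1 h1
    constructor
    · rw [← sub_eq_zero, ← initCoords_joinLast (x - y) t, h2]
      rfl
    · rw [← joinLast_last (x - y) t, h2]
      rfl
  · have hj : Continuous fun t : ℝ => joinLast (x - y) t :=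
      continuous_joinLast.comp (f := fun t : ℝ => (x - y, t)) (by fun_prop)
    refine eq_Ioo_of_symmetric (isOpen_lt (hc.comp hj) continuous_const) ?_ ?_ ?_
    · refine Convex.ordConnected fun t ht u hu a b ha hb hab => ?_
      have e := joinLast_add_smul (x - y) (x - y) t u a b
      rw [← add_smul, hab, one_smul] at e
      have ht' : joinLast (x - y) t ∈ {z | gauge K z < r} := ht
      have hu' : joinLast (x - y) u ∈ {z | gauge K z < r} := hu
      change gauge K _ < r
      rw [smul_eq_mul, smul_eq_mul, e]
      refine (gauge_add_le hK.convex habs _ _).trans_lt ?_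
      rw [gauge_smul_of_nonneg ha, gauge_smul_of_nonneg hb, smul_eq_mul, smul_eq_mul]
      exact convex_Iio r ht' hu' ha hb hab
    · intro t ht
      change gauge K _ < r
      rw [hs.gauge_eq]
      exact ht
    · refine ⟨R * r, fun t ht => ?_⟩
      have h1 := (hRK _).trans (mul_le_mul_of_nonneg_left (le_of_lt ht) hR.le)
      have h2 := PiLp.norm_apply_le (joinLast (x - y) t) (Fin.last m)
      rw [joinLast_last] at h2
      exact (le_abs_self t).trans (h2.trans h1)

/-- The points `(x, u)` and `(x, -u)` have the same gauge `r > 0`, and `(x, t)` lies strictly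
between them. After scaling by `r⁻¹`, strict convexity puts it in the interior of `K`. -/
theorem strictMonoOn_gauge {K : Set (EuclideanSpace ℝ (Fin (m + 1)))} (hK : IsConvexBody K)
    (hneg : ∀ x ∈ K, -x ∈ K) (hs : IsSymmetricInLast K) (hsc : StrictConvex ℝ K)
    (x : EuclideanSpace ℝ (Fin m)) :
    StrictMonoOn (fun t => gauge K (joinLast x t)) (Ici 0) := by
  intro t ht u _ htu
  have h0 := hK.mem_nhds_zero hneg
  obtain ⟨R, hR, hRK⟩ := hK.exists_norm_le_mul_gauge hneg
  have hu0 : 0 < u := lt_of_le_of_lt ht htu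
  set r := gauge K (joinLast x u)
  have hr : 0 < r := by
    have h2 := (PiLp.norm_apply_le (joinLast x u) (Fin.last m)).trans (hRK _)
    rw [joinLast_last, Real.norm_eq_abs, abs_of_pos hu0] at h2
    exact (pos_iff_pos_of_mul_pos (hu0.trans_le h2)).1 hR
  have hmem : ∀ v, gauge K (joinLast x v) = r → r⁻¹ • joinLast x v ∈ K := by
    intro v hv
    have : gauge K (r⁻¹ • joinLast x v) ≤ 1 := by
      rw [gauge_smul_of_nonneg (inv_nonneg.2 hr.le), hv, smul_eq_mul, inv_mul_cancel₀ hr.ne']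
    rwa [gauge_le_one_iff_mem_closure hK.convex h0, hK.isCompact.isClosed.closure_eq] at this
  have hne : r⁻¹ • joinLast x u ≠ r⁻¹ • joinLast x (-u) := by
    intro h
    have h3 := congrArg (fun z : EuclideanSpace ℝ (Fin (m + 1)) => z (Fin.last m))
      (smul_right_injective _ (inv_ne_zero hr.ne') h)
    simp only [joinLast_last] at h3
    linarith
  have ht0 : (0 : ℝ) ≤ t := ht
  have h4 := hsc (hmem u rfl) (hmem (-u) (hs.gauge_eq x u)) hne
    (a := (u + t) / (2 * u)) (b := (u - t) / (2 * u)) (by positivity)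
    (div_pos (by linarith) (by linarith)) (by field_simp; ring)
  have e := joinLast_add_smul x x u (-u) ((u + t) / (2 * u)) ((u - t) / (2 * u))
  rw [← add_smul, show (u + t) / (2 * u) + (u - t) / (2 * u) = 1 by field_simp; ring, one_smul,
    show (u + t) / (2 * u) * u + (u - t) / (2 * u) * -u = t by field_simp; ring] at e
  rw [smul_comm _ r⁻¹, smul_comm _ r⁻¹, ← smul_add, ← e] at h4
  have h5 : gauge K (r⁻¹ • joinLast x t) < 1 := interior_subset_gauge_lt_one K h4
  rw [gauge_smul_of_nonneg (inv_nonneg.2 hr.le), smul_eq_mul, inv_mul_lt_iff₀ hr, mul_one] at h5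
  exact h5

end Splitting

/-! ### Measurable representatives, positive parts and the Euclidean ball -/

section Representative

variable {m : ℕ}

/-- The positive part of an `L^p` function has a measurable representative all of whose slices have
superlevel sets of finite measure. -/
theorem exists_slice_representative {p : ℝ} (hp : 1 ≤ p)
    {f : EuclideanSpace ℝ (Fin (m + 1)) → ℝ} (hf : MemLp f (ENNReal.ofReal p) volume) :
    ∃ F : EuclideanSpace ℝ (Fin m) → ℝ → ℝ, Measurable (Function.uncurry F) ∧
      (∀ x t, 0 ≤ F x t) ∧ (∀ x, ∀ τ > 0, volume {t | F x t > τ} ≠ ⊤) ∧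
      (fun z => max (f z) 0) =ᵐ[volume] fun z => F (initCoords z) (z (Fin.last m)) := by
  have hp0 : 0 < p := by linarith
  set g := hf.1.mk f
  have hg : Measurable g := hf.1.stronglyMeasurable_mk.measurable
  have hfg : f =ᵐ[volume] g := hf.1.ae_eq_mk
  have hj := (continuous_joinLast (m := m)).measurable
  have hgint : Integrable (fun z => ‖g z‖ ^ p) volume := by
    have := (hf.ae_eq hfg).integrable_norm_rpow (by simpa using hp0) ENNReal.ofReal_ne_top
    rwa [ENNReal.toReal_ofReal hp0.le] at this
  have hgm : Measurable fun z : EuclideanSpace ℝ (Fin m) × ℝ => ‖g (joinLast z.1 z.2)‖ ^ p :=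
    ((hg.comp hj).norm).pow_const p
  -- Almost every slice is `p`-integrable. Setting the other slices to `0` makes all superlevel sets
  -- finite for every `x`, by Chebyshev.
  set B := {x : EuclideanSpace ℝ (Fin m) | Integrable (fun t : ℝ => ‖g (joinLast x t)‖ ^ p) volume}
  have hB : MeasurableSet B := measurableSet_integrable (f := fun (x : EuclideanSpace ℝ (Fin m))
    (t : ℝ) => ‖g (joinLast x t)‖ ^ p) hgm.stronglyMeasurable
  have hBae : ∀ᵐ x, x ∈ B := by
    have h1 : Integrable (fun z : EuclideanSpace ℝ (Fin m) × ℝ => ‖g (joinLast z.1 z.2)‖ ^ p)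
        (volume.prod volume) :=
      (measurePreserving_joinLast m).integrable_comp_of_integrable hgint
    exact h1.prod_right_ae
  refine ⟨fun x t => B.indicator (fun x => max (g (joinLast x t)) 0) x, ?_, ?_, ?_, ?_⟩
  · have h1 : Measurable fun z : EuclideanSpace ℝ (Fin m) × ℝ => max (g (joinLast z.1 z.2)) 0 :=
      (hg.comp hj).max measurable_const
    have h2 := h1.indicator (measurable_fst hB)
    convert h2 using 1
    funext z
    rfl
  · exact fun x t => indicator_nonneg (fun _ _ => le_max_right _ _) _
  · intro x τ hτ
    by_cases hx : x ∈ B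
    · have h1 : Integrable (fun t : ℝ => ‖g (joinLast x t)‖ ^ p) volume := hx
      refine ne_top_of_le_ne_top (h1.measure_gt_lt_top (Real.rpow_pos_of_pos hτ p)).ne
        (measure_mono fun t ht => ?_)
      have ht' : τ < max (g (joinLast x t)) 0 := by
        have := ht
        simp only [mem_ofPred_eq, indicator_of_mem hx] at this
        exact this
      have h2 : τ < ‖g (joinLast x t)‖ := by
        rcases lt_max_iff.1 ht' with h | h
        · exact h.trans_le (le_abs_self _)
        · exact absurd h (not_lt.2 hτ.le)
      exact Real.rpow_lt_rpow hτ.le h2 hp0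
    · have : {t : ℝ | B.indicator (fun x => max (g (joinLast x t)) 0) x > τ} = ∅ := by
        ext t
        simp [indicator_of_notMem hx, hτ.le]
      rw [this, measure_empty]
      exact ENNReal.zero_ne_top
  · filter_upwards [hfg, ae_initCoords hBae] with z h1 h2
    rw [indicator_of_mem h2, joinLast_initCoords, h1]

theorem fracEnergy_posPart_le {d : ℕ} {N : EuclideanSpace ℝ (Fin d) → ℝ} (hN : ∀ z, 0 ≤ N z)
    {s p : ℝ} (hp : 0 ≤ p) (f : EuclideanSpace ℝ (Fin d) → ℝ) :
    fracEnergy N s p (fun z => max (f z) 0) ≤ fracEnergy N s p f := by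
  refine lintegral_mono fun x => lintegral_mono fun y => ENNReal.ofReal_le_ofReal ?_
  refine div_le_div_of_nonneg_right ?_ (Real.rpow_nonneg (hN _) _)
  exact Real.rpow_le_rpow (abs_nonneg _) (abs_max_sub_max_le_abs _ _ _) hp

/-- Equality of the finite energies gives `|g⁺ x - g⁺ y| = |g x - g y|` for almost all pairs. If `g
x < 0` at a generic `x`, this forces `g y = g x` for almost every `y`, and a nonzero constant is not
in `L^p`. -/
theorem nonneg_of_fracEnergy_posPart_eq {d : ℕ} (hd : 0 < d) {N : EuclideanSpace ℝ (Fin d) → ℝ}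
    (hN : Measurable N) (hN0 : ∀ z, z ≠ 0 → 0 < N z) (hN1 : ∀ z, 0 ≤ N z)
    {s p : ℝ} (hp : 1 ≤ p) {f : EuclideanSpace ℝ (Fin d) → ℝ}
    (hf : MemLp f (ENNReal.ofReal p) volume) (hE : fracEnergy N s p f ≠ ⊤)
    (h : fracEnergy N s p f = fracEnergy N s p (fun z => max (f z) 0)) : ∀ᵐ z, 0 ≤ f z := by
  have hp0 : 0 < p := by linarith
  set q := (d : ℝ) + s * p with hq
  set g := hf.1.mk f
  have hg : Measurable g := hf.1.stronglyMeasurable_mk.measurable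
  have hfg : f =ᵐ[volume] g := hf.1.ae_eq_mk
  have hfg' : (fun z => max (f z) 0) =ᵐ[volume] fun z => max (g z) 0 := by
    filter_upwards [hfg] with z hz
    rw [hz]
  rw [fracEnergy_congr_ae N s p hfg] at hE h
  rw [fracEnergy_congr_ae N s p hfg'] at h
  have meas : ∀ {k : EuclideanSpace ℝ (Fin d) → ℝ}, Measurable k →
      Measurable fun w : EuclideanSpace ℝ (Fin d) × EuclideanSpace ℝ (Fin d) =>
        ENNReal.ofReal (|k w.1 - k w.2| ^ p / N (w.1 - w.2) ^ q) := fun {k} hk => by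
    refine Measurable.ennreal_ofReal (Measurable.div ?_ ?_)
    · exact (((hk.comp measurable_fst).sub (hk.comp measurable_snd)).abs).pow_const p
    · exact (hN.comp (measurable_fst.sub measurable_snd)).pow_const _
  have hgp : Measurable fun z => max (g z) 0 := hg.max measurable_const
  have key : ∀ᵐ x, ∀ᵐ y, |max (g x) 0 - max (g y) 0| = |g x - g y| := by
    rw [fracEnergy, fracEnergy, ← lintegral_prod _ (meas hg).aemeasurable,
      ← lintegral_prod _ (meas hgp).aemeasurable] at h
    rw [fracEnergy, ← lintegral_prod _ (meas hg).aemeasurable] at hE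
    have hle : ∀ w : EuclideanSpace ℝ (Fin d) × EuclideanSpace ℝ (Fin d),
        ENNReal.ofReal (|max (g w.1) 0 - max (g w.2) 0| ^ p / N (w.1 - w.2) ^ q) ≤
          ENNReal.ofReal (|g w.1 - g w.2| ^ p / N (w.1 - w.2) ^ q) := fun w =>
      ENNReal.ofReal_le_ofReal (div_le_div_of_nonneg_right (Real.rpow_le_rpow (abs_nonneg _)
        (abs_max_sub_max_le_abs (g w.1) (g w.2) 0) hp0.le) (Real.rpow_nonneg (hN1 (w.1 - w.2)) q))
    rw [h] at hE
    have h1 := ae_eq_of_ae_le_of_lintegral_le (Filter.Eventually.of_forall hle)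
      hE (meas hg).aemeasurable h.le
    filter_upwards [Measure.ae_ae_of_ae_prod h1] with x hx
    filter_upwards [hx] with y hy
    by_cases hxy : x = y
    · rw [hxy, sub_self, sub_self]
    · have hq0 : 0 < N (x - y) ^ q := Real.rpow_pos_of_pos (hN0 _ (sub_ne_zero.2 hxy)) _
      have h2 := (ENNReal.ofReal_eq_ofReal_iff
        (div_nonneg (Real.rpow_nonneg (abs_nonneg _) _) hq0.le)
        (div_nonneg (Real.rpow_nonneg (abs_nonneg _) _) hq0.le)).1 hy
      have h3 := (div_left_inj' hq0.ne').1 h2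
      exact (Real.rpow_left_inj (abs_nonneg _) (abs_nonneg _) hp0.ne').1 h3
  suffices hs : ∀ᵐ z, 0 ≤ g z by
    filter_upwards [hs, hfg] with z h1 h2
    rwa [h2]
  by_contra hcon
  have hcon' : ∃ᶠ z in ae volume, ¬ 0 ≤ g z := Filter.not_eventually.1 hcon
  obtain ⟨x, hx, hxy⟩ := (hcon'.and_eventually key).exists
  rw [not_le] at hx
  have hconst : g =ᵐ[volume] fun _ => g x := by
    filter_upwards [hxy] with y hy
    rw [max_eq_right hx.le, zero_sub, abs_neg] at hy
    rcases le_total 0 (g y) with h0 | h0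
    · rw [max_eq_left h0, abs_of_nonneg h0, abs_of_nonpos (by linarith)] at hy
      linarith
    · rw [max_eq_right h0, abs_zero] at hy
      have := abs_eq_zero.1 hy.symm
      linarith
  have hmem := (hf.ae_eq hfg).ae_eq hconst
  rw [memLp_const_iff (by simpa using hp0) ENNReal.ofReal_ne_top] at hmem
  -- Positive dimension makes the space non-compact, so its total volume is infinite.
  have : Nonempty (Fin d) := ⟨⟨0, hd⟩⟩
  rcases hmem with h1 | h1
  · exact hx.ne h1
  · rw [measure_univ_of_isAddLeftInvariant] at h1
    exact lt_irrefl _ h1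

theorem memLp_iff_lintegral_rpow_lt_top {α : Type*} [MeasurableSpace α] {μ : Measure α} {p : ℝ}
    (hp : 0 < p) {g : α → ℝ} (hg : AEStronglyMeasurable g μ) (hg0 : ∀ z, 0 ≤ g z) :
    MemLp g (ENNReal.ofReal p) μ ↔ ∫⁻ z, ENNReal.ofReal (g z ^ p) ∂μ < ⊤ := by
  have h1 : ∀ z, ENNReal.ofReal (g z ^ p) = ‖g z‖ₑ ^ (ENNReal.ofReal p).toReal := by
    intro z
    rw [ENNReal.toReal_ofReal hp.le, Real.enorm_of_nonneg (hg0 z),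
      ENNReal.ofReal_rpow_of_nonneg (hg0 z) hp.le]
  simp_rw [h1]
  rw [← eLpNorm_lt_top_iff_lintegral_rpow_enorm_lt_top (by simpa using hp) ENNReal.ofReal_ne_top]
  exact ⟨fun h => h.2, fun h => ⟨hg, h⟩⟩

theorem steinerSymm_nonneg (f : EuclideanSpace ℝ (Fin (m + 1)) → ℝ)
    (z : EuclideanSpace ℝ (Fin (m + 1))) : 0 ≤ steinerSymm f z :=
  Real.sSup_nonneg fun _ hτ => hτ.1.le

/-- The symmetrization uses only positive levels and sees slices only up to null sets, so it ignores
both the negative part and the choice of representative. -/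
theorem steinerSymm_ae_eq {f : EuclideanSpace ℝ (Fin (m + 1)) → ℝ}
    {F : EuclideanSpace ℝ (Fin m) → ℝ → ℝ}
    (h : (fun z => max (f z) 0) =ᵐ[volume] fun z => F (initCoords z) (z (Fin.last m))) :
    steinerSymm f =ᵐ[volume] fun z => sliceSymm F (initCoords z) (z (Fin.last m)) := by
  have h0 : ∀ᵐ t : ℝ, t ≠ 0 := by simp [ae_iff]
  filter_upwards [ae_initCoords (ae_joinLast h), ae_last h0] with z h1 h2
  simp only [initCoords_joinLast, joinLast_last] at h1
  rw [sliceSymm, if_neg h2, ← lineSymm_congr h1, lineSymm_posPart]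
  rfl

theorem fracEnergy_gauge_ne_top {d : ℕ} {K : Set (EuclideanSpace ℝ (Fin d))}
    (hK : IsConvexBody K) (hneg : ∀ x ∈ K, -x ∈ K) {s p : ℝ} (hs : 0 ≤ s) (hp : 0 < p)
    {f : EuclideanSpace ℝ (Fin d) → ℝ} (hf : fracEnergy (fun z => ‖z‖) s p f ≠ ⊤) :
    fracEnergy (gauge K) s p f ≠ ⊤ := by
  obtain ⟨R, hR, hRK⟩ := hK.exists_norm_le_mul_gauge hneg
  set q := (d : ℝ) + s * p with hq
  have hq0 : 0 ≤ q := by positivity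
  have hRq : 0 ≤ R ^ q := Real.rpow_nonneg hR.le q
  have hle : fracEnergy (gauge K) s p f ≤
      ENNReal.ofReal (R ^ q) * fracEnergy (fun z => ‖z‖) s p f := by
    rw [fracEnergy, fracEnergy, ← lintegral_const_mul' _ _ ENNReal.ofReal_ne_top]
    refine lintegral_mono fun x => ?_
    rw [← lintegral_const_mul' _ _ ENNReal.ofReal_ne_top]
    refine lintegral_mono fun y => ?_
    rw [← ENNReal.ofReal_mul hRq]
    refine ENNReal.ofReal_le_ofReal ?_
    rcases eq_or_ne x y with rfl | hxy
    · rw [sub_self, abs_zero, Real.zero_rpow hp.ne']; simp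
    have h1 : 0 < ‖x - y‖ := norm_pos_iff.2 (sub_ne_zero.2 hxy)
    have h2 : 0 < ‖x - y‖ ^ q := Real.rpow_pos_of_pos h1 q
    have h3 : 0 < gauge K (x - y) :=
      (pos_iff_pos_of_mul_pos (h1.trans_le (hRK _))).1 hR
    have h4 : 0 < gauge K (x - y) ^ q := Real.rpow_pos_of_pos h3 q
    rw [← mul_div_assoc, div_le_div_iff₀ h4 h2]
    have h5 : ‖x - y‖ ^ q ≤ R ^ q * gauge K (x - y) ^ q := by
      rw [← Real.mul_rpow hR.le h3.le]
      exact Real.rpow_le_rpow h1.le (hRK _) hq0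
    nlinarith [mul_le_mul_of_nonneg_left h5 (Real.rpow_nonneg (abs_nonneg (f x - f y)) p)]
  exact ne_top_of_le_ne_top (ENNReal.mul_ne_top ENNReal.ofReal_ne_top hf) hle

theorem isConvexBody_closedBall (d : ℕ) :
    IsConvexBody (Metric.closedBall (0 : EuclideanSpace ℝ (Fin d)) 1) where
  isCompact := isCompact_closedBall _ _
  convex := convex_closedBall _ _
  interior_nonempty :=
    ⟨0, Metric.ball_subset_interior_closedBall (Metric.mem_ball_self one_pos)⟩

theorem neg_mem_closedBall_zero {d : ℕ} (x : EuclideanSpace ℝ (Fin d))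
    (hx : x ∈ Metric.closedBall (0 : EuclideanSpace ℝ (Fin d)) 1) :
    -x ∈ Metric.closedBall (0 : EuclideanSpace ℝ (Fin d)) 1 := by
  simpa using hx

theorem isSymmetricInLast_closedBall :
    IsSymmetricInLast (Metric.closedBall (0 : EuclideanSpace ℝ (Fin (m + 1))) 1) := by
  intro x t h
  rw [mem_closedBall_zero_iff, EuclideanSpace.norm_eq, Fin.sum_univ_castSucc] at h ⊢
  simpa only [joinLast_last, joinLast_castSucc, norm_neg] using h

/-- Membership of `f^#` in the Sobolev space is thereby the energy inequality for the unit ball. -/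
theorem gauge_unit_closedBall (d : ℕ) :
    gauge (Metric.closedBall (0 : EuclideanSpace ℝ (Fin d)) 1) = fun z => ‖z‖ := by
  funext z
  rw [gauge_closedBall zero_le_one, div_one]

end Representative

/-! ### The theorem -/

theorem mainTheorem3 (m : ℕ) (s p : ℝ) (hs0 : 0 < s) (hs1 : s < 1) (hp : 1 ≤ p)
    (K : Set (EuclideanSpace ℝ (Fin (m + 1)))) (hK : IsConvexBody K)
    (hKneg : ∀ x ∈ K, -x ∈ K) (hKsymm : IsSymmetricInLast K)
    (f : EuclideanSpace ℝ (Fin (m + 1)) → ℝ) (hf : MemFracSobolev s p f) :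
    MemFracSobolev s p (steinerSymm f) ∧
    fracEnergy (gauge K) s p (steinerSymm f) ≤ fracEnergy (gauge K) s p f ∧
    (StrictConvex ℝ K →
      (1 < p →
        (fracEnergy (gauge K) s p f = fracEnergy (gauge K) s p (steinerSymm f) ↔
          ∃ c : ℝ, ∀ᵐ x' : EuclideanSpace ℝ (Fin m), ∀ᵐ t : ℝ,
            f (joinLast x' t) = steinerSymm f (joinLast x' (t - c)))) ∧
      (p = 1 →
        (fracEnergy (gauge K) s p f = fracEnergy (gauge K) s p (steinerSymm f) ↔
          (∀ᵐ x, 0 ≤ f x) ∧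
          ∀ᵐ τ : ℝ, 0 < τ → ∃ c : ℝ, ∀ᵐ x' : EuclideanSpace ℝ (Fin m), ∃ r : ℝ,
            {t : ℝ | f (joinLast x' t) > τ} =ᵐ[volume] Ioo (c - r) (c + r)))) := by

  have hp0 : 0 < p := by linarith
  have hN := isSliceKernel_gauge hK hKneg hKsymm
  have hB := isSliceKernel_gauge (isConvexBody_closedBall (m + 1)) neg_mem_closedBall_zero
    isSymmetricInLast_closedBall
  have hNc : Measurable (gauge K) :=
    (continuous_gauge hK.convex (hK.mem_nhds_zero hKneg)).measurable
  have hBc : Measurable (gauge (Metric.closedBall (0 : EuclideanSpace ℝ (Fin (m + 1))) 1)) := by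
    rw [gauge_unit_closedBall]
    exact measurable_norm
  have hq : 0 < ((m + 1 : ℕ) : ℝ) + s * p := by positivity
  obtain ⟨hfp, hfE⟩ := hf
  rw [ENNReal.rpow_lt_top_iff_of_pos (by positivity)] at hfE
  obtain ⟨F, hF, hF0, hfin, hFf⟩ := exists_slice_representative hp hfp
  have hG := isSliceSymm_sliceSymm hF hfin
  have hGm := measurable_sliceSymm hF hfin
  have hG0 := sliceSymm_nonneg F
  have hGf := steinerSymm_ae_eq hFf
  have mF : Measurable fun z : EuclideanSpace ℝ (Fin (m + 1)) => F (initCoords z) (z (Fin.last m)) :=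
    hF.comp (splitLast m).measurable
  have mG : Measurable fun z : EuclideanSpace ℝ (Fin (m + 1)) =>
      sliceSymm F (initCoords z) (z (Fin.last m)) :=
    hGm.comp (splitLast m).measurable
  have eF : ∀ N : EuclideanSpace ℝ (Fin (m + 1)) → ℝ, Measurable N →
      fracEnergy N s p (fun z => max (f z) 0) =
        sliceEnergy volume (fun x y t => N (joinLast (x - y) t)) (((m + 1 : ℕ) : ℝ) + s * p) p F := by
    intro N hN
    rw [fracEnergy_congr_ae N s p hFf, fracEnergy_eq_sliceEnergy hN s p mF]
    simp only [initCoords_joinLast, joinLast_last]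
  have eG : ∀ N : EuclideanSpace ℝ (Fin (m + 1)) → ℝ, Measurable N →
      fracEnergy N s p (steinerSymm f) =
        sliceEnergy volume (fun x y t => N (joinLast (x - y) t)) (((m + 1 : ℕ) : ℝ) + s * p) p
          (sliceSymm F) := by
    intro N hN
    rw [fracEnergy_congr_ae N s p hGf, fracEnergy_eq_sliceEnergy hN s p mG]
    simp only [initCoords_joinLast, joinLast_last]
  have slice_le : ∀ N : EuclideanSpace ℝ (Fin (m + 1)) → ℝ, Measurable N →
      IsSliceKernel (fun (x y : EuclideanSpace ℝ (Fin m)) t => N (joinLast (x - y) t)) →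
      fracEnergy N s p (steinerSymm f) ≤ fracEnergy N s p (fun z => max (f z) 0) := by
    intro N h1 h2
    rw [eF N h1, eG N h1]
    exact sliceEnergy_sliceSymm_le volume h2 hF hF0 hfin hGm hG0 hG hp hq
  have hle := (slice_le _ hNc hN).trans (fracEnergy_posPart_le (s := s) (p := p)
    (gauge_nonneg (s := K)) hp0.le f)
  have hKfin : fracEnergy (gauge K) s p f ≠ ⊤ :=
    fracEnergy_gauge_ne_top hK hKneg hs0.le hp0 hfE.ne
  -- slices of `f` and of its symmetrization
  have sF : ∀ᵐ x : EuclideanSpace ℝ (Fin m), ∀ᵐ t : ℝ, max (f (joinLast x t)) 0 = F x t := by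
    filter_upwards [ae_joinLast hFf] with x hx
    simpa only [initCoords_joinLast, joinLast_last] using hx
  have sG : ∀ᵐ x : EuclideanSpace ℝ (Fin m), ∀ᵐ t : ℝ,
      steinerSymm f (joinLast x t) = sliceSymm F x t := by
    filter_upwards [ae_joinLast hGf] with x hx
    simpa only [initCoords_joinLast, joinLast_last] using hx
  have sLevel : ∀ᵐ x : EuclideanSpace ℝ (Fin m), ∀ τ > 0,
      {t : ℝ | f (joinLast x t) > τ} =ᵐ[volume] {t | F x t > τ} := by
    filter_upwards [sF] with x hx τ hτ
    filter_upwards [hx] with t ht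
    refine propext ?_
    change f (joinLast x t) > τ ↔ F x t > τ
    rw [← ht]
    simp [not_lt.2 (le_of_lt hτ)]
  refine ⟨⟨?_, ?_⟩, hle, fun hsc => ?_⟩
  · rw [memLp_congr_ae hGf, memLp_iff_lintegral_rpow_lt_top hp0 mG.aestronglyMeasurable
      fun z => hG0 _ _]
    have h1 : MemLp (fun z => max (f z) 0) (ENNReal.ofReal p) volume := hfp.pos_part
    rw [memLp_congr_ae hFf, memLp_iff_lintegral_rpow_lt_top hp0 mF.aestronglyMeasurable
      fun z => hF0 _ _] at h1
    rw [lintegral_eq_lintegral_joinLast (mF.pow_const p).ennreal_ofReal] at h1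
    rw [lintegral_eq_lintegral_joinLast (mG.pow_const p).ennreal_ofReal]
    simp only [initCoords_joinLast, joinLast_last] at h1 ⊢
    refine lt_of_eq_of_lt (lintegral_congr fun x => ?_) h1
    exact lintegral_rpow_eq_of_isSliceSymm hG hfin x hF.of_uncurry_left hGm.of_uncurry_left
      (hF0 x) (hG0 x) hp0
  · rw [ENNReal.rpow_lt_top_iff_of_pos (by positivity)]
    have h1 := slice_le _ hBc hB
    rw [gauge_unit_closedBall] at h1
    exact (h1.trans (fracEnergy_posPart_le (fun z => norm_nonneg z) hp0.le f)).trans_lt hfE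
  have hmono : ∀ x y : EuclideanSpace ℝ (Fin m),
      StrictMonoOn (fun t => gauge K (joinLast (x - y) t)) (Ici 0) :=
    fun x y => strictMonoOn_gauge hK hKneg hKsymm hsc (x - y)
  -- equality forces nonnegativity and equality of the slice energies
  have hforward : fracEnergy (gauge K) s p f = fracEnergy (gauge K) s p (steinerSymm f) →
      (∀ᵐ z, 0 ≤ f z) ∧
      sliceEnergy volume (fun (x y : EuclideanSpace ℝ (Fin m)) t => gauge K (joinLast (x - y) t))
        (((m + 1 : ℕ) : ℝ) + s * p) p F =
      sliceEnergy volume (fun (x y : EuclideanSpace ℝ (Fin m)) t => gauge K (joinLast (x - y) t))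
        (((m + 1 : ℕ) : ℝ) + s * p) p (sliceSymm F) ∧
      sliceEnergy volume (fun (x y : EuclideanSpace ℝ (Fin m)) t => gauge K (joinLast (x - y) t))
        (((m + 1 : ℕ) : ℝ) + s * p) p F ≠ ⊤ := by
    intro h
    have h1 : fracEnergy (gauge K) s p f = fracEnergy (gauge K) s p (fun z => max (f z) 0) :=
      le_antisymm (h.le.trans (slice_le _ hNc hN))
        (fracEnergy_posPart_le (gauge_nonneg (s := K)) hp0.le f)
    obtain ⟨R, hR, hRK⟩ := hK.exists_norm_le_mul_gauge hKneg
    refine ⟨nonneg_of_fracEnergy_posPart_eq (Nat.succ_pos m) hNc (fun z hz => ?_)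
      (gauge_nonneg (s := K)) hp hfp hKfin h1, ?_, ?_⟩
    · exact (pos_iff_pos_of_mul_pos ((norm_pos_iff.2 hz).trans_le (hRK z))).1 hR
    · rw [← eF _ hNc, ← eG _ hNc, ← h1, h]
    · rw [← eF _ hNc, ← h1]
      exact hKfin
  have hbackward : (∀ᵐ z, 0 ≤ f z) →
      sliceEnergy volume (fun (x y : EuclideanSpace ℝ (Fin m)) t => gauge K (joinLast (x - y) t))
        (((m + 1 : ℕ) : ℝ) + s * p) p F =
      sliceEnergy volume (fun (x y : EuclideanSpace ℝ (Fin m)) t => gauge K (joinLast (x - y) t))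
        (((m + 1 : ℕ) : ℝ) + s * p) p (sliceSymm F) →
      fracEnergy (gauge K) s p f = fracEnergy (gauge K) s p (steinerSymm f) := by
    intro h1 h2
    rw [eG _ hNc, ← h2, ← eF _ hNc]
    refine fracEnergy_congr_ae _ _ _ ?_
    filter_upwards [h1] with z hz
    rw [max_eq_left hz]
  obtain ⟨ν, _, hν0, hν, hν1, hνac⟩ := exists_measure_lintegral_sub_eq_rpow hp
  refine ⟨fun hp1 => ⟨fun h => ?_, ?_⟩, fun hp1 => ⟨fun h => ?_, ?_⟩⟩
  · obtain ⟨h1, h2, h3⟩ := hforward h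
    have h4 := concentric_levels_of_sliceEnergy_eq volume hN hmono hF hF0 hfin hGm hG0 hG hp hν0 hν
      hq h2 h3
    -- For `p > 1` the measure `ν` dominates Lebesgue measure on `(0, ∞)`, so almost all pairs of
    -- distinct levels are concentric.
    have h5 := ((hνac hp1).prod (Measure.AbsolutelyContinuous.refl
      (volume.restrict (Ioi (0 : ℝ))))).ae_le h4
    obtain ⟨c, hc⟩ := exists_center_all_levels hF h5
    refine ⟨c, ?_⟩
    filter_upwards [ae_eq_translate_of_center hF0 hfin hG0 hG hc, ae_joinLast h1, sF, sG]
      with x k1 k2 k3 k4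
    have k5 := (measurePreserving_sub_right volume c).quasiMeasurePreserving.ae k4
    filter_upwards [k1, k2, k3, k5] with t l1 l2 l3 l4
    rw [l4, ← l1, ← l3, max_eq_left l2]
  · rintro ⟨c, hc⟩
    have h1 : ∀ᵐ z, 0 ≤ f z := by
      -- The slicewise sign information passes to the whole space through a measurable
      -- representative, since `f` itself is only almost everywhere measurable.
      have e1 := hfp.1.ae_eq_mk
      have h2 : ∀ᵐ z, 0 ≤ hfp.1.mk f z := by
        refine ae_of_ae_joinLast (measurableSet_le measurable_const
          hfp.1.stronglyMeasurable_mk.measurable) ?_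
        filter_upwards [hc, ae_joinLast e1] with x k1 k2
        filter_upwards [k1, k2] with t l1 l2
        rw [← l2, l1]
        exact steinerSymm_nonneg _ _
      filter_upwards [e1, h2] with z k1 k2
      rwa [k1]
    refine hbackward h1 (sliceEnergy_sliceSymm_eq volume hN hF hF0 hfin hGm hG0 hG hp hν0 hν hq ?_)
    have h2 : ∀ᵐ x : EuclideanSpace ℝ (Fin m), ∀ᵐ t : ℝ, F x t = sliceSymm F x (t - c) := by
      filter_upwards [hc, ae_joinLast h1, sF, sG] with x k1 k2 k3 k4
      have k5 := (measurePreserving_sub_right volume c).quasiMeasurePreserving.ae k4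
      filter_upwards [k1, k2, k3, k5] with t l1 l2 l3 l4
      rw [← l3, max_eq_left l2, l1, l4]
    filter_upwards [ae_nonneg_and_pos_prod hν0] with g hg
    refine ⟨c, ?_⟩
    filter_upwards [h2] with x hx
    exact ⟨isCenteredInterval_of_translate hfin hG hx (by linarith),
      isCenteredInterval_of_translate hfin hG hx hg.2⟩
  · obtain ⟨h1, h2, h3⟩ := hforward h
    refine ⟨h1, ?_⟩
    have h4 := concentric_levels_of_sliceEnergy_eq volume hN hmono hF hF0 hfin hGm hG0 hG hp hν0 hν
      hq h2 h3
    -- For `p = 1` only `h = 0` is charged, so each level is compared with itself over different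
    -- base points.
    rw [hν1 hp1] at h4
    have h5 := Measure.ae_ae_of_ae_prod h4
    rw [ae_dirac_eq] at h5
    have h6 := (ae_restrict_iff' measurableSet_Ioi).1 (show _ from h5)
    filter_upwards [h6] with τ hτ hτ0
    have h7 := hτ hτ0
    simp only [add_zero] at h7
    have h8 : ∃ c, ∀ᵐ x : EuclideanSpace ℝ (Fin m), IsCenteredInterval {t | F x t > τ} c := by
      by_cases hne : ∃ᶠ x in ae (volume : Measure (EuclideanSpace ℝ (Fin m))),
          volume {t | F x t > τ} ≠ 0
      · obtain ⟨c, hc, -⟩ := exists_common_center le_rfl hne h7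
        exact ⟨c, hc⟩
      · rw [Filter.not_frequently] at hne
        refine ⟨0, ?_⟩
        filter_upwards [hne] with x hx
        exact isCenteredInterval_of_volume_eq_zero (not_not.1 hx) 0
    obtain ⟨c, hc⟩ := h8
    refine ⟨c, ?_⟩
    filter_upwards [hc, sLevel] with x ⟨r, hr⟩ hx
    exact ⟨r, (hx τ hτ0).trans hr⟩
  · rintro ⟨h1, h2⟩
    refine hbackward h1 (sliceEnergy_sliceSymm_eq volume hN hF hF0 hfin hGm hG0 hG hp hν0 hν hq ?_)
    have h3 : ∀ᵐ σ ∂(volume.restrict (Ioi (0 : ℝ))), ∃ c, ∀ᵐ x : EuclideanSpace ℝ (Fin m),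
        IsCenteredInterval {t | F x t > σ} c := by
      rw [ae_restrict_iff' measurableSet_Ioi]
      filter_upwards [h2] with σ hσ hσ0
      obtain ⟨c, hc⟩ := hσ hσ0
      refine ⟨c, ?_⟩
      filter_upwards [hc, sLevel] with x ⟨r, hr⟩ hx
      exact ⟨r, (hx σ hσ0).symm.trans hr⟩
    -- With `h = 0` almost surely, the two levels coincide and a center depending on the level
    -- suffices.
    have h4 : ∀ᵐ h ∂ν, h = 0 := by
      rw [hν1 hp1, ae_dirac_eq]
      exact rfl
    filter_upwards [Measure.quasiMeasurePreserving_fst.ae h4,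
      Measure.quasiMeasurePreserving_snd.ae h3] with g hg ⟨c, hc⟩
    refine ⟨c, ?_⟩
    filter_upwards [hc] with x hx
    rw [hg, add_zero]
    exact ⟨hx, hx⟩
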